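/- **Notation.** Let $d\in\mathbb N$ and let $(\rho_i)_{i\ge -1}$ be a dyadic partition of unity of $\mathbb R^d$: the functions $\rho_i:\mathbb R^d\to[0,1]$ are smooth, radial and compactly supported, $\operatorname{supp}\rho_{-1}\subset\{|x|<\tfrac43\}$, $\operatorname{supp}\rho_0\subset\{\tfrac34<|x|<\tfrac83\}$, $\rho_i=\rho_0(2^{-i}\,\cdot)$ for $i\ge0$, and $\sum_{i\ge-1}\rho_i=1$. With $\mathscr F\varphi(\xi)=\int\varphi(x)e^{-2\pi \mathrm i\langle x,\xi\rangle}dx$, set $Q_i=\mathscr F^{-1}\rho_i$, $\Delta_if=\mathscr F^{-1}(\rho_i\mathscr Ff)$ for $f\in\mathcal S'(\mathbb R^d)$, and $P_j=\sum_{-1\le i\le j-2}Q_i$ (so $P_j=0$ for $j\le0$). For $\alpha\in\mathbb R$ let $\|f\|_{\mathcal C^\alpha}=\sup_{i\ge-1}2^{\alpha i}\|\Delta_if\|_{L^\infty}$ and $\mathcal C^\alpha(\mathbb R^d)=\{f\in\mathcal S'(\mathbb R^d):\|f\|_{\mathcal C^\alpha}<\infty\}$. For a family $\Lambda=(\Lambda_x)_{x\in\mathbb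 R^d}$ of tempered distributions let $$\mathbf P(\Lambda)=\sum_{j\ge1}\mathbf Q_j\Lambda,\qquad (\mathbf Q_j\Lambda)(x)=\int P_j(x-y)\,\langle\Lambda_y,Q_j(x-\cdot)\rangle\,dy ,$$ the series being taken in $\mathcal S'(\mathbb R^d)$. **Proposition.** Let $\gamma,\beta_0\in\mathbb R$ and let $(\Lambda_x)_{x\in\mathbb R^d}$ be tempered distributions on $\mathbb R^d$ with $\sup_x\|\Lambda_x\|_{\mathcal C^{\beta_0}}<\infty$. Assume that, for some finite $N$, for all $x,y\in\mathbb R^d$, $$\Lambda_y-\Lambda_x=\sum_{\ell=1}^N c^\ell_{yx}\,\Theta^\ell_x ,$$ where $\Theta^\ell_x$ are tempered distributions and the coefficients $c^\ell_{yx}\in\mathbb R$ depend measurably on $(y,x)$, and that there are exponents $\beta_\ell<\gamma$ such that, for each $1\le\ell\le N$, $$\sup_{x\in\mathbb R^d}\sup_{j\ge-1}2^{j\beta_\ell}\big|\langle\Theta^\ell_x,P_j(x-\cdot)\rangle\big|<\infty,\qquad |c^\ell_{yx}|\le C_\ell\,|y-x|^{\gamma-\beta_\ell}\ \text{ for some }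 C_\ell<\infty \text{ and all } x,y\in\mathbb R^d .$$ Then the integrals defining $\mathbf Q_j\Lambda$ converge, the series $\mathbf P(\Lambda)$ converges in $\mathcal S'(\mathbb R^d)$, and: * If $\gamma>0$, there is a unique $f_\Lambda\in\mathcal C^\gamma(\mathbb R^d)$ for which there is a constant $C$ with $$\big|\big\langle\mathbf P(\Lambda)-f_\Lambda-\Lambda_x,\,P_i(x-\cdot)\big\rangle\big|\le C\,2^{-i\gamma}\qquad\text{for all }x\in\mathbb R^d,\ i\ge-1 .$$ It is a bounded continuous function, and it is real-valued if all the $\Lambda_x$ are real-valued distributions. * If $\gamma<0$, there is a constant $C$ with $$\big|\big\langle\mathbf P(\Lambda)-\Lambda_x,\,P_i(x-\cdot)\big\rangle\big|\le C\,2^{-i\gamma}\qquad\text{for all }x\in\mathbb R^d,\ i\ge-1 .$$ -/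

import Mathlib

open MeasureTheory Set
open scoped SchwartzMap FourierTransform ContDiff ENNReal BoundedContinuousFunction

noncomputable section

/-- A dyadic partition of unity of `ℝ^d`: `low` is `ρ₋₁` and `ring` is `ρ₀`; the other members
`ρ_i = ρ₀(2^{-i} ·)`, `i ≥ 1`, are obtained from `ring`, see `DyadicPartition.rho`. -/
structure DyadicPartition (d : ℕ) where
  low : EuclideanSpace ℝ (Fin d) → ℝ
  ring : EuclideanSpace ℝ (Fin d) → ℝ
  low_smooth : ContDiff ℝ ∞ low
  ring_smooth : ContDiff ℝ ∞ ring
  low_radial : ∀ x y, ‖x‖ = ‖y‖ → low x = low y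
  ring_radial : ∀ x y, ‖x‖ = ‖y‖ → ring x = ring y
  low_mem : ∀ x, low x ∈ Icc (0 : ℝ) 1
  ring_mem : ∀ x, ring x ∈ Icc (0 : ℝ) 1
  low_supp : tsupport low ⊆ {x | ‖x‖ < 4 / 3}
  ring_supp : tsupport ring ⊆ {x | 3 / 4 < ‖x‖ ∧ ‖x‖ < 8 / 3}
  sum_eq_one : ∀ x, HasSum (fun i : ℕ => ring (((2 : ℝ) ^ i)⁻¹ • x)) (1 - low x)

/-- The tempered distribution `φ ↦ ∫ φ f` of a bounded continuous function `f`. -/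
def boundedDistribution {d : ℕ} (f : EuclideanSpace ℝ (Fin d) →ᵇ ℂ) :
    𝓢'(EuclideanSpace ℝ (Fin d), ℂ) :=
  Lp.toTemperedDistribution (p := ∞) (μ := volume)
    ((memLp_top_of_bound f.continuous.aestronglyMeasurable ‖f‖
      (Filter.Eventually.of_forall f.norm_coe_le_norm)).toLp f)

/-- The `L^∞` norm of a tempered distribution; it is `∞` if the distribution is not given by a
function in `L^∞`. -/
def linftyNorm {d : ℕ} (T : 𝓢'(EuclideanSpace ℝ (Fin d), ℂ)) : ℝ≥0∞ :=
  ⨅ (u : Lp ℂ ∞ (volume : Measure (EuclideanSpace ℝ (Fin d))))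
    (_ : Lp.toTemperedDistribution u = T), ‖u‖ₑ

/-- A real-valued distribution: it takes real values on real-valued test functions. -/
def IsRealDistribution {d : ℕ} (T : 𝓢'(EuclideanSpace ℝ (Fin d), ℂ)) : Prop :=
  ∀ φ : 𝓢(EuclideanSpace ℝ (Fin d), ℂ), (∀ y, (φ y).im = 0) → (T φ).im = 0

/-- The test function `φ(x - ·)`. -/
def reflectAt {d : ℕ} (φ : 𝓢(EuclideanSpace ℝ (Fin d), ℂ)) (x : EuclideanSpace ℝ (Fin d)) :
    𝓢(EuclideanSpace ℝ (Fin d), ℂ) :=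
  SchwartzMap.compSubConstCLM ℂ x
    (SchwartzMap.compCLMOfContinuousLinearEquiv ℂ
      (ContinuousLinearEquiv.neg ℝ (M := EuclideanSpace ℝ (Fin d))) φ)

theorem reflectAt_apply {d : ℕ} (φ : 𝓢(EuclideanSpace ℝ (Fin d), ℂ))
    (x y : EuclideanSpace ℝ (Fin d)) : reflectAt φ x y = φ (x - y) := by
  simp [reflectAt]

namespace DyadicPartition

variable {d : ℕ} (ρ : DyadicPartition d)

/-- The function `ρ_i`, for `i ≥ -1`; by convention it is `0` for `i < -1`. -/
def rho (i : ℤ) (x : EuclideanSpace ℝ (Fin d)) : ℝ :=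
  if i = -1 then ρ.low x else if 0 ≤ i then ρ.ring (((2 : ℝ) ^ i)⁻¹ • x) else 0

theorem low_hasCompactSupport : HasCompactSupport ρ.low :=
  HasCompactSupport.of_support_subset_isCompact
    (isCompact_closedBall (0 : EuclideanSpace ℝ (Fin d)) (4 / 3))
    fun x hx => by
      have h := ρ.low_supp (subset_tsupport _ hx)
      simpa using (le_of_lt h)

theorem ring_hasCompactSupport : HasCompactSupport ρ.ring :=
  HasCompactSupport.of_support_subset_isCompact
    (isCompact_closedBall (0 : EuclideanSpace ℝ (Fin d)) (8 / 3))
    fun x hx => by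
      have h := (ρ.ring_supp (subset_tsupport _ hx)).2
      simpa using (le_of_lt h)

theorem rho_hasCompactSupport (i : ℤ) : HasCompactSupport fun x => (ρ.rho i x : ℂ) := by
  have h : HasCompactSupport (ρ.rho i) := by
    unfold rho
    by_cases h1 : i = -1
    · simpa [h1] using ρ.low_hasCompactSupport
    · by_cases h2 : 0 ≤ i
      · simp only [h1, h2, if_true, if_false]
        exact ρ.ring_hasCompactSupport.comp_smul (by positivity)
      · simp only [h1, h2, if_false]
        exact HasCompactSupport.zero
  exact h.comp_left (g := fun t : ℝ => (t : ℂ)) (by simp)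

theorem rho_contDiff (i : ℤ) : ContDiff ℝ ∞ fun x => (ρ.rho i x : ℂ) := by
  have h : ContDiff ℝ ∞ (ρ.rho i) := by
    unfold rho
    by_cases h1 : i = -1
    · simpa [h1] using ρ.low_smooth
    · by_cases h2 : 0 ≤ i
      · simp only [h1, h2, if_true, if_false]
        exact ρ.ring_smooth.comp (contDiff_const_smul _)
      · simpa [h1, h2] using contDiff_const
  exact Complex.ofRealCLM.contDiff.comp h

/-- The kernel `Q_i = 𝓕⁻¹ ρ_i` of the Littlewood-Paley block `Δ_i`. -/
def kerQ (i : ℤ) : 𝓢(EuclideanSpace ℝ (Fin d), ℂ) :=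
  𝓕⁻ ((ρ.rho_hasCompactSupport i).toSchwartzMap (ρ.rho_contDiff i))

/-- The kernel `P_j = ∑_{-1 ≤ i ≤ j - 2} Q_i`; in particular `P_j = 0` for `j ≤ 0`. -/
def kerP (j : ℤ) : 𝓢(EuclideanSpace ℝ (Fin d), ℂ) :=
  ∑ i ∈ Finset.Icc (-1) (j - 2), ρ.kerQ i

/-- The Littlewood-Paley block `Δ_i f = 𝓕⁻¹ (ρ_i 𝓕 f)`. -/
def block (i : ℤ) (f : 𝓢'(EuclideanSpace ℝ (Fin d), ℂ)) : 𝓢'(EuclideanSpace ℝ (Fin d), ℂ) :=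
  TemperedDistribution.fourierMultiplierCLM ℂ (fun x => (ρ.rho i x : ℂ)) f

/-- The Hölder-Besov norm `sup_{i ≥ -1} 2^{α i} ‖Δ_i f‖_{L^∞}`. -/
def holderNorm (α : ℝ) (f : 𝓢'(EuclideanSpace ℝ (Fin d), ℂ)) : ℝ≥0∞ :=
  ⨆ (i : ℤ) (_ : -1 ≤ i), ENNReal.ofReal ((2 : ℝ) ^ (α * i)) * linftyNorm (ρ.block i f)

/-- `f ∈ C^α(ℝ^d) = B^α_{∞,∞}(ℝ^d)`. -/
def MemHolder (α : ℝ) (f : 𝓢'(EuclideanSpace ℝ (Fin d), ℂ)) : Prop :=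
  ρ.holderNorm α f < ⊤

/-- `(𝐐_j Λ)(x) = ∬ P_j(x - y) Q_j(x - z) Λ_y(z) dy dz`, the integral in `z` being the pairing
of `Λ_y` with `Q_j(x - ·)`. -/
def bigQ (Λ : EuclideanSpace ℝ (Fin d) → 𝓢'(EuclideanSpace ℝ (Fin d), ℂ)) (j : ℤ)
    (x : EuclideanSpace ℝ (Fin d)) : ℂ :=
  ∫ y, ρ.kerP j (x - y) * Λ y (reflectAt (ρ.kerQ j) x)

/-- `T` is the two-parameter paraproduct `𝐏(Λ) = ∑_{j ≥ 1} 𝐐_j Λ`: all the integrals converge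
and the series converges to `T` in the sense of tempered distributions. -/
structure IsParaproduct (Λ : EuclideanSpace ℝ (Fin d) → 𝓢'(EuclideanSpace ℝ (Fin d), ℂ))
    (T : 𝓢'(EuclideanSpace ℝ (Fin d), ℂ)) : Prop where
  integrable_kernel : ∀ j : ℤ, 1 ≤ j → ∀ x,
    Integrable fun y => ρ.kerP j (x - y) * Λ y (reflectAt (ρ.kerQ j) x)
  integrable_test : ∀ j : ℤ, 1 ≤ j → ∀ φ : 𝓢(EuclideanSpace ℝ (Fin d), ℂ),
    Integrable fun x => φ x * ρ.bigQ Λ j x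
  hasSum : ∀ φ : 𝓢(EuclideanSpace ℝ (Fin d), ℂ),
    HasSum (fun n : ℕ => ∫ x, φ x * ρ.bigQ Λ (n + 1) x) (T φ)

/-- The bound `|⟨T - Λ_x, P_i(x - ·)⟩| ≲ 2^{-iγ}`, uniformly in `x` and in `i ≥ -1`. -/
def Reconstructs (γ : ℝ) (Λ : EuclideanSpace ℝ (Fin d) → 𝓢'(EuclideanSpace ℝ (Fin d), ℂ))
    (T : 𝓢'(EuclideanSpace ℝ (Fin d), ℂ)) : Prop :=
  ∃ C : ℝ, ∀ x : EuclideanSpace ℝ (Fin d), ∀ i : ℤ, -1 ≤ i →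
    ‖(T - Λ x) (reflectAt (ρ.kerP i) x)‖ ≤ C * (2 : ℝ) ^ (-(i : ℝ) * γ)

end DyadicPartition

end

/-
Since `P_j` has integral `1` for `j ≥ 1`, the blocks of `𝐏(Λ)` and `Λ_x` differ by the local error
`(𝐐_j Λ)(z) - ⟨Λ_x, Q_j(z - ·)⟩ = ∫ P_j(z - y) ⟨Λ_y - Λ_x, Q_j(z - ·)⟩ dy`. Writing
`Λ_y - Λ_x = (Λ_y - Λ_z) - (Λ_x - Λ_z)` and `Q_j = P_{j+2} - P_{j+1}`, the expansion of the
increments bounds it by `2^{-jγ} (1 + 2^j |x - z|)^n`, a weight which disappears when one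
integrates in `z` against a kernel centred at `x` and living at scale `2^{-i}` with `j ≤ i + 4`.

The functions `𝐐_j Λ` grow at most like a power of `2^j` and their spectrum lies in a shell of
radius of order `2^j`, so the series converges after division by a high power of the frequency.
Moreover `P_i(x - ·)` only sees the local errors with `j ≤ i + 2`, and `Q_k(x - ·)` only those with
`k - 2 ≤ j ≤ k + 4`. If `γ < 0`, the geometric sum of `2^{-jγ}` over `j ≤ i + 2` is of order
`2^{-iγ}`. If `γ > 0`, then `⟨𝐏(Λ) - Λ_x, Q_k(x - ·)⟩` is of order `2^{-kγ}`, so that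
`⟨𝐏(Λ) - Λ_x, P_n(x - ·)⟩` converges as `n → ∞`, with the rate `2^{-nγ}`; its limit is the
correction `f(x)`. This `f` is in `C^γ` because `Q_k ∗ P_k = 0`: for each `x`,
`⟨f, Q_k(x - ·)⟩ = -∫ Q_k(x - z) (⟨𝐏(Λ) - Λ_x, P_k(z - ·)⟩ - f(z)) dz`, and the integrand is
small. Finally, two corrections differ by a distribution whose pairings with `P_n(x - ·)` tend to
`0` uniformly in `x`, which must therefore vanish.
-/

noncomputable section

open Filter Topology Module
open scoped Convolution

section Cutoff

variable {V F 𝕜 : Type*} [NormedAddCommGroup V] [NormedSpace ℝ V] [RCLike 𝕜]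
  [NormedAddCommGroup F] [NormedSpace ℝ F] [NormedSpace 𝕜 F]

theorem iteratedFDeriv_eq_zero_of_norm_lt {f : V → F} {R : ℝ} (hf : ∀ ξ, ‖ξ‖ < R → f ξ = 0)
    (n : ℕ) {x : V} (hx : ‖x‖ < R) : iteratedFDeriv ℝ n f x = 0 := by
  have hzero : f =ᶠ[𝓝 x] fun _ => 0 := by
    filter_upwards [(continuous_norm.tendsto x).eventually (gt_mem_nhds hx)] with ξ hξ
    exact hf ξ hξ
  rw [(hzero.iteratedFDeriv ℝ n).eq_of_nhds, iteratedFDeriv_fun_zero, Pi.zero_apply]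

theorem pow_mul_norm_iteratedFDeriv_smul_le {m : V → 𝕜} (hm : ContDiff ℝ ∞ m) {R : ℝ}
    (hR : 0 < R) (hm0 : ∀ ξ, ‖ξ‖ < R → m ξ = 0) {B : ℕ → ℝ}
    (hB : ∀ i x, ‖iteratedFDeriv ℝ i m x‖ ≤ B i) (φ : 𝓢(V, F)) (k n : ℕ) (x : V) :
    ‖x‖ ^ k * ‖iteratedFDeriv ℝ n (fun ξ => m ξ • φ ξ) x‖ ≤
      R⁻¹ * ∑ i ∈ Finset.range (n + 1),
        (n.choose i : ℝ) * B i * SchwartzMap.seminorm ℝ (k + 1) (n - i) φ := by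
  have hB0 (i : ℕ) : 0 ≤ B i := (norm_nonneg _).trans (hB i 0)
  rcases lt_or_ge ‖x‖ R with hx | hx
  · rw [iteratedFDeriv_eq_zero_of_norm_lt (fun ξ hξ => by rw [hm0 ξ hξ, zero_smul]) n hx,
      norm_zero, mul_zero]
    exact mul_nonneg (by positivity) (Finset.sum_nonneg fun i _ =>
      mul_nonneg (mul_nonneg (Nat.cast_nonneg _) (hB0 i)) (apply_nonneg _ _))
  · have hx0 : 0 < ‖x‖ := hR.trans_le hx
    have hφ (i : ℕ) : ‖x‖ ^ k * ‖iteratedFDeriv ℝ (n - i) φ x‖ ≤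
        R⁻¹ * SchwartzMap.seminorm ℝ (k + 1) (n - i) φ := by
      rw [le_inv_mul_iff₀ hR]
      calc R * (‖x‖ ^ k * ‖iteratedFDeriv ℝ (n - i) φ x‖)
          ≤ ‖x‖ * (‖x‖ ^ k * ‖iteratedFDeriv ℝ (n - i) φ x‖) := by gcongr
        _ = ‖x‖ ^ (k + 1) * ‖iteratedFDeriv ℝ (n - i) φ x‖ := by ring
        _ ≤ _ := SchwartzMap.le_seminorm ℝ (k + 1) (n - i) φ x
    calc ‖x‖ ^ k * ‖iteratedFDeriv ℝ n (fun ξ => m ξ • φ ξ) x‖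
        ≤ ‖x‖ ^ k * ∑ i ∈ Finset.range (n + 1), (n.choose i : ℝ) * ‖iteratedFDeriv ℝ i m x‖ *
            ‖iteratedFDeriv ℝ (n - i) φ x‖ := by
          gcongr
          exact norm_iteratedFDeriv_smul_le hm (φ.smooth ⊤) x (by exact_mod_cast le_top)
      _ = ∑ i ∈ Finset.range (n + 1), (n.choose i : ℝ) * ‖iteratedFDeriv ℝ i m x‖ *
            (‖x‖ ^ k * ‖iteratedFDeriv ℝ (n - i) φ x‖) := by
          rw [Finset.mul_sum]
          exact Finset.sum_congr rfl fun i _ => by ring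
      _ ≤ ∑ i ∈ Finset.range (n + 1), (n.choose i : ℝ) * B i *
            (R⁻¹ * SchwartzMap.seminorm ℝ (k + 1) (n - i) φ) := by
          refine Finset.sum_le_sum fun i _ => mul_le_mul ?_ (hφ i) (by positivity)
            (mul_nonneg (Nat.cast_nonneg _) (hB0 i))
          gcongr
          exact hB i x
      _ = _ := by
          rw [Finset.mul_sum]
          exact Finset.sum_congr rfl fun i _ => by ring

theorem norm_iteratedFDeriv_comp_smul_sub_one_le (χ : 𝓢(V, 𝕜)) {t : ℝ} (ht : |t| ≤ 1) (i : ℕ)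
    (x : V) : ‖iteratedFDeriv ℝ i (fun ξ => χ (t • ξ) - 1) x‖ ≤
      SchwartzMap.seminorm ℝ 0 i χ + 1 := by
  have hχt : ContDiff ℝ i fun ξ => χ (t • ξ) := (χ.smooth i).comp (contDiff_const_smul t)
  rw [fun_iteratedFDeriv_sub_apply hχt.contDiffAt contDiff_const.contDiffAt,
    iteratedFDeriv_comp_const_smul t (χ.smooth i)]
  refine (norm_sub_le _ _).trans (add_le_add ?_ ?_)
  · rw [norm_smul, norm_pow, Real.norm_eq_abs]
    exact (mul_le_of_le_one_left (norm_nonneg _) (pow_le_one₀ (abs_nonneg t) ht)).trans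
      (SchwartzMap.norm_iteratedFDeriv_le_seminorm ℝ χ i (t • x))
  · rcases Nat.eq_zero_or_pos i with rfl | hi
    · simp
    · simp [iteratedFDeriv_const_of_ne hi.ne']

theorem exists_seminorm_smulLeftCLM_sub_le {χ : 𝓢(V, 𝕜)} {r : ℝ} (hr : 0 < r)
    (hχ : ∀ ξ, ‖ξ‖ < r → χ ξ = 1) (φ : 𝓢(V, F)) (k n : ℕ) :
    ∃ C, ∀ t ∈ Ioc (0 : ℝ) 1, SchwartzMap.seminorm ℝ k n
      (SchwartzMap.smulLeftCLM F (fun ξ => χ (t • ξ)) φ - φ) ≤ t * C := by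
  refine ⟨r⁻¹ * ∑ i ∈ Finset.range (n + 1), (n.choose i : ℝ) *
    (SchwartzMap.seminorm ℝ 0 i χ + 1) * SchwartzMap.seminorm ℝ (k + 1) (n - i) φ,
    fun t ht => ?_⟩
  have ht0 : 0 < t := ht.1
  have hgrowth : (fun ξ => χ (t • ξ)).HasTemperateGrowth := by fun_prop
  have hcoe : ⇑(SchwartzMap.smulLeftCLM F (fun ξ => χ (t • ξ)) φ - φ) =
      fun ξ => (χ (t • ξ) - 1) • φ ξ := by
    funext ξ
    simp [SchwartzMap.smulLeftCLM_apply_apply hgrowth, sub_smul]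
  refine SchwartzMap.seminorm_le_bound ℝ k n _ ?_ fun x => ?_
  · positivity
  · rw [hcoe]
    refine (pow_mul_norm_iteratedFDeriv_smul_le (R := r / t) ?_ (by positivity) (fun ξ hξ => ?_)
      (norm_iteratedFDeriv_comp_smul_sub_one_le χ ?_) φ k n x).trans_eq ?_
    · exact ((χ.smooth ⊤).comp (contDiff_const_smul _)).sub contDiff_const
    · rw [hχ _ ?_, sub_self]
      rwa [norm_smul, Real.norm_of_nonneg ht0.le, ← lt_div_iff₀' ht0]
    · rw [abs_of_pos ht0]
      exact ht.2
    · rw [inv_div, div_eq_mul_inv, mul_assoc]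

theorem tendsto_smulLeftCLM_comp_smul {χ : 𝓢(V, 𝕜)} {r : ℝ} (hr : 0 < r)
    (hχ : ∀ ξ, ‖ξ‖ < r → χ ξ = 1) (φ : 𝓢(V, F)) :
    Tendsto (fun t : ℝ => SchwartzMap.smulLeftCLM F (fun ξ => χ (t • ξ)) φ) (𝓝[>] 0) (𝓝 φ) := by
  rw [(schwartz_withSeminorms ℝ V F).tendsto_nhds]
  rintro ⟨k, n⟩ ε hε
  obtain ⟨C, hC⟩ := exists_seminorm_smulLeftCLM_sub_le hr hχ φ k n
  have hlim : Tendsto (fun t : ℝ => t * C) (𝓝[>] 0) (𝓝 0) := by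
    simpa using ((continuous_mul_const C).tendsto 0).mono_left nhdsWithin_le_nhds
  filter_upwards [hlim.eventually (gt_mem_nhds hε), Ioc_mem_nhdsGT one_pos] with t htε ht
  exact (hC t ht).trans_lt htε

end Cutoff

section WeightedIntegrals

variable {α : Type*} [MeasurableSpace α] {μ : Measure α} {K v : α → ℂ} {W : α → ℝ} {D : ℝ}

theorem norm_integral_mul_le_of_norm_le_weight (hKW : Integrable (fun w => ‖K w‖ * W w) μ)
    (hvW : ∀ w, ‖v w‖ ≤ D * W w) : ‖∫ w, K w * v w ∂μ‖ ≤ D * ∫ w, ‖K w‖ * W w ∂μ := by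
  rw [← integral_const_mul]
  refine norm_integral_le_of_norm_le (hKW.const_mul D) (.of_forall fun w => ?_)
  calc ‖K w * v w‖ = ‖K w‖ * ‖v w‖ := norm_mul _ _
    _ ≤ ‖K w‖ * (D * W w) := by gcongr; exact hvW w
    _ = D * (‖K w‖ * W w) := by ring

theorem norm_integral_mul_le_of_norm_le (hK : Integrable K μ) (hv : ∀ w, ‖v w‖ ≤ D) :
    ‖∫ w, K w * v w ∂μ‖ ≤ D * ∫ w, ‖K w‖ ∂μ := by
  simpa using norm_integral_mul_le_of_norm_le_weight (W := fun _ => 1) (by simpa using hK.norm)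
    (by simpa using hv)

end WeightedIntegrals

section Fourier

variable {V : Type*} [NormedAddCommGroup V] [InnerProductSpace ℝ V] [FiniteDimensional ℝ V]
  [MeasurableSpace V] [BorelSpace V]

/-- The transpose `φ ↦ 𝓕 (g 𝓕⁻¹ φ)` of the Fourier multiplier with symbol `g`, by which the
multiplier acts on tempered distributions. -/
def transposeMultiplier (g : V → ℂ) : 𝓢(V, ℂ) →L[ℂ] 𝓢(V, ℂ) :=
  FourierTransform.fourierCLM ℂ 𝓢(V, ℂ) ∘L SchwartzMap.smulLeftCLM ℂ g ∘L
    FourierTransform.fourierInvCLM ℂ 𝓢(V, ℂ)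

theorem fourierMultiplierCLM_apply_eq_transposeMultiplier (g : V → ℂ) (T : 𝓢'(V, ℂ))
    (φ : 𝓢(V, ℂ)) :
    TemperedDistribution.fourierMultiplierCLM ℂ g T φ = T (transposeMultiplier g φ) := rfl

theorem transposeMultiplier_apply_eq (g : V → ℂ) (φ : 𝓢(V, ℂ)) :
    transposeMultiplier g φ = 𝓕 (SchwartzMap.smulLeftCLM ℂ g (𝓕⁻ φ)) := rfl

theorem fourierInv_transposeMultiplier {g : V → ℂ} (hg : g.HasTemperateGrowth) (φ : 𝓢(V, ℂ))
    (ξ : V) : 𝓕⁻ (transposeMultiplier g φ) ξ = g ξ * 𝓕⁻ φ ξ := by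
  simp [transposeMultiplier, hg]

theorem schwartzMap_ext_fourierInv {φ ψ : 𝓢(V, ℂ)} (h : ∀ ξ, 𝓕⁻ φ ξ = 𝓕⁻ ψ ξ) : φ = ψ := by
  have h' : 𝓕⁻ φ = 𝓕⁻ ψ := SchwartzMap.ext h
  simpa using congrArg (fun f : 𝓢(V, ℂ) => 𝓕 f) h'

theorem transposeMultiplier_eq_zero {g : V → ℂ} (hg : g.HasTemperateGrowth) {φ : 𝓢(V, ℂ)}
    (h : ∀ ξ, g ξ ≠ 0 → 𝓕⁻ φ ξ = 0) : transposeMultiplier g φ = 0 := by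
  refine schwartzMap_ext_fourierInv fun ξ => ?_
  rw [fourierInv_transposeMultiplier hg, FourierTransform.fourierInv_zero, zero_apply,
    mul_eq_zero]
  exact or_iff_not_imp_left.2 (h ξ)

theorem transposeMultiplier_eq_self {g : V → ℂ} (hg : g.HasTemperateGrowth) {φ : 𝓢(V, ℂ)}
    (h : ∀ ξ, 𝓕⁻ φ ξ ≠ 0 → g ξ = 1) : transposeMultiplier g φ = φ := by
  refine schwartzMap_ext_fourierInv fun ξ => ?_
  rw [fourierInv_transposeMultiplier hg]
  by_cases hξ : 𝓕⁻ φ ξ = 0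
  · rw [hξ, mul_zero]
  · rw [h ξ hξ, one_mul]

theorem transposeMultiplier_transposeMultiplier {g₁ g₂ g₃ : V → ℂ} (h₁ : g₁.HasTemperateGrowth)
    (h₂ : g₂.HasTemperateGrowth) (h₃ : g₃.HasTemperateGrowth) (h : ∀ ξ, g₁ ξ * g₂ ξ = g₃ ξ)
    (φ : 𝓢(V, ℂ)) :
    transposeMultiplier g₁ (transposeMultiplier g₂ φ) = transposeMultiplier g₃ φ := by
  refine schwartzMap_ext_fourierInv fun ξ => ?_
  rw [fourierInv_transposeMultiplier h₁, fourierInv_transposeMultiplier h₂,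
    fourierInv_transposeMultiplier h₃, ← h, mul_assoc]

theorem fourier_compSubConst_fourierInv (g : 𝓢(V, ℂ)) (w ξ : V) :
    𝓕 (SchwartzMap.compSubConstCLM ℂ w (𝓕⁻ g)) ξ =
      (Real.fourierChar (-inner ℝ ξ w) : ℂ) * g ξ := by
  have hg : g ξ = 𝓕 (𝓕⁻ g) ξ := by rw [FourierTransform.fourier_fourierInv_eq]
  rw [hg, SchwartzMap.fourier_coe, SchwartzMap.fourier_coe, Real.fourier_eq, Real.fourier_eq,
    ← integral_add_right_eq_self _ w, ← integral_const_mul]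
  refine integral_congr_ae (.of_forall fun v => ?_)
  simp only [SchwartzMap.compSubConstCLM_apply, add_sub_cancel_right, Circle.smul_def,
    smul_eq_mul, inner_add_left, neg_add, AddChar.map_add_eq_mul, Circle.coe_mul,
    real_inner_comm w ξ]
  ring

theorem transposeMultiplier_apply (g φ : 𝓢(V, ℂ)) (w : V) :
    transposeMultiplier g φ w = ∫ z, φ z * 𝓕⁻ g (z - w) := by
  have hparseval := SchwartzMap.integral_fourierInv_mul_eq φ
    (𝓕 (SchwartzMap.compSubConstCLM ℂ w (𝓕⁻ g)))
  simp only [FourierTransform.fourierInv_fourier_eq, SchwartzMap.compSubConstCLM_apply] at hparseval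
  rw [← hparseval, transposeMultiplier_apply_eq, SchwartzMap.fourier_coe, Real.fourier_eq]
  refine integral_congr_ae (.of_forall fun v => ?_)
  simp only [fourier_compSubConst_fourierInv, Circle.smul_def, smul_eq_mul,
    SchwartzMap.smulLeftCLM_apply_apply g.hasTemperateGrowth]
  ring

theorem fourierInv_mul_translate_eq_zero {p φ : 𝓢(V, ℂ)} (y : V) {ξ : V}
    (h : ∀ η, p η ≠ 0 → 𝓕⁻ φ (ξ + η) = 0) :
    𝓕⁻ (SchwartzMap.smulLeftCLM ℂ (SchwartzMap.compSubConstCLM ℂ y (𝓕⁻ p)) φ) ξ = 0 := by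
  have hparseval := SchwartzMap.integral_fourierInv_mul_eq
    (𝓕 (SchwartzMap.compSubConstCLM ℂ y (𝓕⁻ p)))
    (𝓕 (SchwartzMap.compSubConstCLM ℂ (-ξ) (𝓕⁻ φ)))
  simp only [FourierTransform.fourierInv_fourier_eq, fourier_compSubConst_fourierInv,
    SchwartzMap.compSubConstCLM_apply, inner_neg_right, neg_neg, sub_neg_eq_add] at hparseval
  rw [SchwartzMap.fourierInv_coe, Real.fourierInv_eq]
  refine Eq.trans (integral_congr_ae (.of_forall fun v => ?_)) (hparseval.trans ?_)
  · simp only [SchwartzMap.smulLeftCLM_apply_apply (SchwartzMap.hasTemperateGrowth _),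
      SchwartzMap.compSubConstCLM_apply, Circle.smul_def, smul_eq_mul]
    ring
  · refine integral_eq_zero_of_ae (.of_forall fun η => ?_)
    by_cases hη : p η = 0
    · simp [hη]
    · simp [add_comm η ξ, h η hη]

theorem im_fourierInv_eq_zero {g : 𝓢(V, ℂ)} (him : ∀ ξ, (g ξ).im = 0)
    (heven : ∀ ξ, g (-ξ) = g ξ) (x : V) : (𝓕⁻ g x).im = 0 := by
  rw [← Complex.conj_eq_iff_im, SchwartzMap.fourierInv_coe, Real.fourierInv_eq, ← integral_conj,
    ← integral_neg_eq_self]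
  refine integral_congr_ae (.of_forall fun v => ?_)
  simp only [Circle.smul_def, smul_eq_mul, map_mul, heven, inner_neg_left,
    Complex.conj_eq_iff_im.2 (him v)]
  rw [AddChar.map_neg_eq_inv, Circle.coe_inv_eq_conj, Complex.conj_conj]

section Dilation

variable {g g' : 𝓢(V, ℂ)} {r : ℝ}

theorem fourierInv_dilate (hr : 0 < r) (h : ∀ ξ, g' ξ = g (r⁻¹ • ξ)) (x : V) :
    𝓕⁻ g' x = (r : ℂ) ^ finrank ℝ V * 𝓕⁻ g (r • x) := by
  have hscale := Measure.integral_comp_inv_smul_of_nonneg (volume : Measure V)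
    (fun v : V => Real.fourierChar (inner ℝ v (r • x)) • g v) hr.le
  rw [Complex.real_smul] at hscale
  push_cast at hscale
  rw [SchwartzMap.fourierInv_coe, SchwartzMap.fourierInv_coe, Real.fourierInv_eq,
    Real.fourierInv_eq, ← hscale]
  refine integral_congr_ae (.of_forall fun v => ?_)
  simp only [h, real_inner_smul_left, real_inner_smul_right, mul_inv_cancel_left₀ hr.ne']

theorem integral_fourierInv_dilate_mul (hr : 0 < r) (h : ∀ ξ, g' ξ = g (r⁻¹ • ξ)) (v : V → ℂ) :
    ∫ x, 𝓕⁻ g' x * v (r • x) = ∫ x, 𝓕⁻ g x * v x := by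
  have hscale := Measure.integral_comp_smul_of_nonneg (volume : Measure V)
    (fun x => 𝓕⁻ g x * v x) r (hR := hr.le)
  rw [Complex.real_smul] at hscale
  simp only [fourierInv_dilate hr h, mul_assoc, integral_const_mul, hscale]
  push_cast
  rw [mul_inv_cancel_left₀ (pow_ne_zero _ (by exact_mod_cast hr.ne'))]

theorem integral_norm_fourierInv_dilate_mul (hr : 0 < r) (h : ∀ ξ, g' ξ = g (r⁻¹ • ξ))
    (W : V → ℝ) : ∫ x, ‖𝓕⁻ g' x‖ * W (r • x) = ∫ x, ‖𝓕⁻ g x‖ * W x := by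
  have hscale := Measure.integral_comp_smul_of_nonneg (volume : Measure V)
    (fun x => ‖𝓕⁻ g x‖ * W x) r (hR := hr.le)
  simp only [fourierInv_dilate hr h, norm_mul, norm_pow, Complex.norm_real,
    Real.norm_of_nonneg hr.le, mul_assoc, integral_const_mul, hscale, smul_eq_mul]
  rw [mul_inv_cancel_left₀ (by positivity)]

theorem convolution_fourierInv_dilate (hr : 0 < r) (h : ∀ ξ, g' ξ = g (r⁻¹ • ξ)) (v : V → ℂ)
    (x : V) : ((𝓕⁻ g' : 𝓢(V, ℂ)) ⋆[.mul ℂ ℂ] v) x = ∫ w, 𝓕⁻ g w * v (x - r⁻¹ • w) := by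
  rw [← integral_fourierInv_dilate_mul hr h fun w => v (x - r⁻¹ • w)]
  simp only [smul_smul, inv_mul_cancel₀ hr.ne', one_smul]
  rfl

end Dilation

section SchwartzConvolution

variable {F : Type*} [NormedAddCommGroup F] [NormedSpace ℝ F]

theorem exists_integrable_forall_norm_translate_le (K : 𝓢(V, F)) (z₀ : V) :
    ∃ b : V → ℝ, Integrable b ∧ ∀ z ∈ Metric.closedBall z₀ 1, ∀ w, ‖K (z - w)‖ ≤ b w := by
  obtain ⟨n, hn⟩ : ∃ n : ℕ, (finrank ℝ V : ℝ) < n := exists_nat_gt _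
  set M := 2 ^ n * ((Finset.Iic (n, 0)).sup fun m => SchwartzMap.seminorm ℝ m.1 m.2) K
  have hM (y : V) : (1 + ‖y‖) ^ n * ‖K y‖ ≤ M := by
    simpa using SchwartzMap.one_add_le_sup_seminorm_apply (𝕜 := ℝ) (m := (n, 0)) (k := n) (n := 0)
      le_rfl le_rfl K y
  refine ⟨fun w => 2 ^ n * M * (1 + ‖z₀ - w‖) ^ (-(n : ℝ)),
    ((integrable_one_add_norm hn).comp_sub_left z₀).const_mul _, fun z hz w => ?_⟩
  rw [mem_closedBall_iff_norm'] at hz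
  have hPeetre : 1 + ‖z₀ - w‖ ≤ 2 * (1 + ‖z - w‖) := by
    linarith [norm_sub_le_norm_sub_add_norm_sub z₀ z w, norm_nonneg (z - w)]
  beta_reduce
  rw [Real.rpow_neg (by positivity), Real.rpow_natCast, ← div_eq_mul_inv,
    le_div_iff₀ (by positivity)]
  calc ‖K (z - w)‖ * (1 + ‖z₀ - w‖) ^ n ≤ ‖K (z - w)‖ * (2 * (1 + ‖z - w‖)) ^ n := by gcongr
    _ = 2 ^ n * ((1 + ‖z - w‖) ^ n * ‖K (z - w)‖) := by rw [mul_pow]; ring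
    _ ≤ 2 ^ n * M := by gcongr; exact hM _

variable {K : 𝓢(V, ℂ)} {v : V → ℂ} {C : ℝ}

theorem norm_convolution_le (hv : ∀ x, ‖v x‖ ≤ C) (z : V) :
    ‖(K ⋆[.mul ℂ ℂ] v) z‖ ≤ C * ∫ w, ‖K w‖ :=
  norm_integral_mul_le_of_norm_le K.integrable fun w => hv (z - w)

theorem continuous_convolution (hv : AEStronglyMeasurable v) (hC : ∀ x, ‖v x‖ ≤ C) :
    Continuous (K ⋆[.mul ℂ ℂ] v) := by
  refine continuous_iff_continuousAt.2 fun z₀ => ?_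
  obtain ⟨b, hb, hKb⟩ := exists_integrable_forall_norm_translate_le K z₀
  have hconv : ⇑K ⋆[.mul ℂ ℂ] v = fun z => ∫ w, K (z - w) * v w := by
    funext z
    exact convolution_mul_swap
  rw [hconv]
  refine continuousAt_of_dominated (bound := fun w => b w * C) (.of_forall fun z => ?_) ?_
    (hb.mul_const C) (.of_forall fun w => ?_)
  · exact (K.continuous.comp (continuous_sub_left z)).aestronglyMeasurable.mul hv
  · filter_upwards [Metric.closedBall_mem_nhds z₀ one_pos] with z hz
    refine .of_forall fun w => ?_
    rw [norm_mul]
    exact mul_le_mul (hKb z hz w) (hC w) (norm_nonneg _) ((norm_nonneg _).trans (hKb z hz w))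
  · exact ((K.continuous.comp (continuous_sub_right w)).mul continuous_const).continuousAt

theorem integrable_mul_comp_sub {φ K : V → ℂ} (hφ : Integrable φ) (hK : Integrable K) :
    Integrable (fun p : V × V => φ p.1 * K (p.1 - p.2)) (volume.prod volume) := by
  simpa [Function.comp_def] using
    (hφ.convolution_integrand (ContinuousLinearMap.mul ℂ ℂ) hK.comp_neg).swap

theorem integral_transposeMultiplier_mul (g φ : 𝓢(V, ℂ)) (hv : AEStronglyMeasurable v)
    (hC : ∀ x, ‖v x‖ ≤ C) :
    ∫ w, transposeMultiplier g φ w * v w = ∫ z, φ z * ((𝓕⁻ g : 𝓢(V, ℂ)) ⋆[.mul ℂ ℂ] v) z := by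
  have hprod : Integrable (fun p : V × V => φ p.2 * 𝓕⁻ g (p.2 - p.1) * v p.1)
      (volume.prod volume) :=
    (integrable_mul_comp_sub φ.integrable (𝓕⁻ g).integrable).swap.mul_bdd hv.comp_fst
      (.of_forall fun p => hC p.1)
  simp only [transposeMultiplier_apply, ← integral_mul_const]
  rw [integral_integral_swap hprod]
  simp only [mul_assoc, integral_const_mul, convolution_mul_swap]

end SchwartzConvolution

end Fourier

section ScaledMoments

variable {V : Type*} [NormedAddCommGroup V] [InnerProductSpace ℝ V] [FiniteDimensional ℝ V]
  [MeasurableSpace V] [BorelSpace V]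

/-- The kernels `K j`, `j ≥ -1`, live at scale `2^{-j}`: all their moments, measured in this
scale, are bounded uniformly in `j`. -/
def HasScaledMoments (K : ℤ → 𝓢(V, ℂ)) : Prop :=
  ∀ n : ℕ, ∃ M : ℝ, ∀ j : ℤ, -1 ≤ j → ∫ x, ‖K j x‖ * (1 + 2 ^ j * ‖x‖) ^ n ≤ M

theorem integrable_norm_mul_one_add_pow (K : 𝓢(V, ℂ)) (c : ℝ) (n : ℕ) (x : V) :
    Integrable fun z => ‖K (x - z)‖ * (1 + c * ‖x - z‖) ^ n := by
  have hK : Integrable fun z => ‖K z‖ * (1 + c * ‖z‖) ^ n := by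
    simp only [add_comm (1 : ℝ), add_pow, one_pow, mul_one, Finset.mul_sum, mul_pow]
    refine integrable_finsetSum _ fun i _ => ?_
    refine ((K.integrable_pow_mul volume i).const_mul (c ^ i * n.choose i)).congr
      (.of_forall fun z => ?_)
    simp only
    ring
  exact hK.comp_sub_left x

theorem hasScaledMoments_fourierInv_of_dilate {g : ℤ → 𝓢(V, ℂ)}
    (hg : ∀ j : ℤ, 1 ≤ j → ∀ ξ, g j ξ = g 1 (((2 : ℝ) ^ (j - 1))⁻¹ • ξ)) :
    HasScaledMoments fun j => 𝓕⁻ (g j) := by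
  intro n
  set m : ℤ → ℝ := fun j => ∫ x, ‖𝓕⁻ (g j) x‖ * (1 + 2 ^ j * ‖x‖) ^ n
  have hm (j : ℤ) : 0 ≤ m j := integral_nonneg fun x => by positivity
  have hscale (j : ℤ) (hj : 1 ≤ j) : m j = m 1 := by
    refine Eq.trans ?_ (integral_norm_fourierInv_dilate_mul (by positivity) (hg j hj)
      fun x => (1 + (2 : ℝ) ^ (1 : ℤ) * ‖x‖) ^ n)
    refine integral_congr_ae (.of_forall fun x => ?_)
    simp only [norm_smul, norm_zpow, Real.norm_two, ← mul_assoc,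
      ← zpow_add₀ (two_ne_zero' ℝ), add_sub_cancel]
  refine ⟨m (-1) + m 0 + m 1, fun j hj => ?_⟩
  obtain rfl | rfl | h : j = -1 ∨ j = 0 ∨ 1 ≤ j := by lia
  · exact (le_add_of_nonneg_right (hm 0)).trans (le_add_of_nonneg_right (hm 1))
  · exact (le_add_of_nonneg_left (hm (-1))).trans (le_add_of_nonneg_right (hm 1))
  · exact (hscale j h).trans_le (le_add_of_nonneg_left (add_nonneg (hm _) (hm _)))

variable {K : ℤ → 𝓢(V, ℂ)}

theorem HasScaledMoments.exists_norm_integral_mul_le (hK : HasScaledMoments K) (n : ℕ) :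
    ∃ M : ℝ, 0 ≤ M ∧ ∀ j : ℤ, -1 ≤ j → ∀ (x : V) (v : V → ℂ) (D : ℝ),
      (∀ z, ‖v z‖ ≤ D * (1 + 2 ^ j * ‖x - z‖) ^ n) → ‖∫ z, K j (x - z) * v z‖ ≤ M * D := by
  obtain ⟨M, hM⟩ := hK n
  refine ⟨M, (integral_nonneg fun x => by positivity).trans (hM (-1) le_rfl),
    fun j hj x v D hv => ?_⟩
  have hD : 0 ≤ D := by simpa using (norm_nonneg _).trans (hv x)
  refine (norm_integral_mul_le_of_norm_le_weight
    (integrable_norm_mul_one_add_pow (K j) _ n x) hv).trans ?_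
  rw [integral_sub_left_eq_self (fun z => ‖K j z‖ * (1 + 2 ^ j * ‖z‖) ^ n), mul_comm]
  exact mul_le_mul_of_nonneg_right (hM j hj) hD

theorem HasScaledMoments.exists_integral_norm_le (hK : HasScaledMoments K) :
    ∃ M : ℝ, 0 ≤ M ∧ ∀ j : ℤ, -1 ≤ j → ∫ x, ‖K j x‖ ≤ M := by
  obtain ⟨M, hM⟩ := hK 0
  simp only [pow_zero, mul_one] at hM
  exact ⟨M, (integral_nonneg fun x => norm_nonneg _).trans (hM (-1) le_rfl), hM⟩

end ScaledMoments

section Kernels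

variable {d : ℕ}

local notation "𝔼" => EuclideanSpace ℝ (Fin d)

theorem fourierInv_reflectAt (K : 𝓢(𝔼, ℂ)) (x ξ : 𝔼) :
    𝓕⁻ (reflectAt K x) ξ = (Real.fourierChar (inner ℝ x ξ) : ℂ) * 𝓕 K ξ := by
  rw [SchwartzMap.fourierInv_coe, SchwartzMap.fourier_coe, Real.fourierInv_eq, Real.fourier_eq,
    ← integral_sub_left_eq_self _ volume x, ← integral_const_mul]
  refine integral_congr_ae (.of_forall fun v => ?_)
  simp only [reflectAt_apply, sub_sub_cancel, Circle.smul_def, smul_eq_mul, inner_sub_left]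
  rw [sub_eq_add_neg, AddChar.map_add_eq_mul, Circle.coe_mul]
  ring

theorem transposeMultiplier_reflectAt {g : 𝔼 → ℂ} (hg : g.HasTemperateGrowth) {a b : 𝓢(𝔼, ℂ)}
    (h : ∀ ξ, g ξ * a ξ = b ξ) (x : 𝔼) :
    transposeMultiplier g (reflectAt (𝓕⁻ a) x) = reflectAt (𝓕⁻ b) x := by
  refine schwartzMap_ext_fourierInv fun ξ => ?_
  rw [fourierInv_transposeMultiplier hg, fourierInv_reflectAt, fourierInv_reflectAt,
    FourierTransform.fourier_fourierInv_eq, FourierTransform.fourier_fourierInv_eq, ← h]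
  ring

theorem reflectAt_add (K L : 𝓢(𝔼, ℂ)) (x : 𝔼) :
    reflectAt (K + L) x = reflectAt K x + reflectAt L x := by
  simp [reflectAt]

namespace DyadicPartition

variable (ρ : DyadicPartition d)

theorem ring_eq_zero_of_norm_le {ξ : 𝔼} (h : ‖ξ‖ ≤ 3 / 4) : ρ.ring ξ = 0 := by
  by_contra h0
  exact absurd (ρ.ring_supp (subset_tsupport _ h0)).1 (not_lt.2 h)

theorem ring_eq_zero_of_le_norm {ξ : 𝔼} (h : 8 / 3 ≤ ‖ξ‖) : ρ.ring ξ = 0 := by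
  by_contra h0
  exact absurd (ρ.ring_supp (subset_tsupport _ h0)).2 (not_lt.2 h)

theorem low_eq_zero_of_le_norm {ξ : 𝔼} (h : 4 / 3 ≤ ‖ξ‖) : ρ.low ξ = 0 := by
  by_contra h0
  exact absurd (ρ.low_supp (subset_tsupport _ h0)) (not_lt.2 h)

theorem low_eq_one_of_norm_le {ξ : 𝔼} (h : ‖ξ‖ ≤ 3 / 4) : ρ.low ξ = 1 := by
  have hring : (fun i : ℕ => ρ.ring (((2 : ℝ) ^ i)⁻¹ • ξ)) = fun _ => 0 := by
    funext i
    refine ρ.ring_eq_zero_of_norm_le ?_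
    rw [norm_smul, norm_inv, norm_pow, Real.norm_two]
    exact (mul_le_of_le_one_left (norm_nonneg ξ)
      (inv_le_one_of_one_le₀ (one_le_pow₀ one_le_two))).trans h
  have hsum := ρ.sum_eq_one ξ
  rw [hring] at hsum
  linarith [hsum.unique hasSum_zero]

theorem low_half (ξ : 𝔼) : ρ.low ((2 : ℝ)⁻¹ • ξ) = ρ.low ξ + ρ.ring ξ := by
  have hhalf := ρ.sum_eq_one ((2 : ℝ)⁻¹ • ξ)
  simp only [smul_smul, ← mul_inv, ← pow_succ] at hhalf
  have htail := (hasSum_nat_add_iff' 1).2 (ρ.sum_eq_one ξ)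
  have heq := hhalf.unique htail
  simp only [Finset.sum_range_one, pow_zero, inv_one, one_smul] at heq
  linarith

/-- The symbol `ρ_i` of the Littlewood-Paley block, as a Schwartz function. -/
def symQ (i : ℤ) : 𝓢(𝔼, ℂ) := (ρ.rho_hasCompactSupport i).toSchwartzMap (ρ.rho_contDiff i)

/-- The Fourier transform `∑_{-1 ≤ i ≤ j - 2} ρ_i` of the kernel `P_j`. -/
def symP (j : ℤ) : 𝓢(𝔼, ℂ) := ∑ i ∈ Finset.Icc (-1) (j - 2), ρ.symQ i

theorem symQ_apply (i : ℤ) (ξ : 𝔼) : ρ.symQ i ξ = (ρ.rho i ξ : ℂ) := rfl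

theorem symQ_apply_of_nonneg {i : ℤ} (hi : 0 ≤ i) (ξ : 𝔼) :
    ρ.symQ i ξ = (ρ.ring (((2 : ℝ) ^ i)⁻¹ • ξ) : ℂ) := by
  rw [symQ_apply, rho, if_neg (by lia), if_pos hi]

theorem kerQ_eq_fourierInv (i : ℤ) : ρ.kerQ i = 𝓕⁻ (ρ.symQ i) := rfl

theorem kerP_eq_fourierInv (j : ℤ) : ρ.kerP j = 𝓕⁻ (ρ.symP j) := by
  simp [kerP, symP, kerQ_eq_fourierInv]

theorem symP_of_nonpos {j : ℤ} (hj : j ≤ 0) : ρ.symP j = 0 := by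
  rw [symP, Finset.Icc_eq_empty (by lia), Finset.sum_empty]

theorem kerP_of_nonpos {j : ℤ} (hj : j ≤ 0) : ρ.kerP j = 0 := by
  rw [kerP, Finset.Icc_eq_empty (by lia), Finset.sum_empty]

theorem symP_add_two {j : ℤ} (hj : -1 ≤ j) : ρ.symP (j + 2) = ρ.symP (j + 1) + ρ.symQ j := by
  have hIcc : Finset.Icc (-1) (j + 2 - 2) = insert j (Finset.Icc (-1) (j + 1 - 2)) := by
    ext i
    simp only [Finset.mem_Icc, Finset.mem_insert]
    lia
  rw [symP, hIcc, Finset.sum_insert (by simp; lia), add_comm, symP]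

theorem kerP_add_two {j : ℤ} (hj : -1 ≤ j) : ρ.kerP (j + 2) = ρ.kerP (j + 1) + ρ.kerQ j := by
  simp only [kerP_eq_fourierInv, kerQ_eq_fourierInv, ρ.symP_add_two hj,
    FourierTransform.fourierInv_add]

theorem symP_apply {j : ℤ} (hj : 1 ≤ j) (ξ : 𝔼) :
    ρ.symP j ξ = (ρ.low (((2 : ℝ) ^ (j - 1))⁻¹ • ξ) : ℂ) := by
  induction j, hj using Int.leInduction with
  | base => simp [symP, symQ_apply, rho]
  | succ j hj ih =>
    have hsucc := ρ.symP_add_two (j := j - 1) (by lia)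
    rw [show j - 1 + 2 = j + 1 by ring, sub_add_cancel] at hsucc
    have hlow := ρ.low_half (((2 : ℝ) ^ (j - 1))⁻¹ • ξ)
    rw [smul_smul, ← mul_inv, ← zpow_one_add₀ two_ne_zero, add_sub_cancel] at hlow
    rw [hsucc, add_apply, ih, ρ.symQ_apply_of_nonneg (by lia), add_sub_cancel_right, hlow,
      Complex.ofReal_add]

theorem norm_two_zpow_inv_smul (j : ℤ) (ξ : 𝔼) : ‖((2 : ℝ) ^ j)⁻¹ • ξ‖ = ‖ξ‖ / 2 ^ j := by
  rw [norm_smul, norm_inv, norm_zpow, Real.norm_two, inv_mul_eq_div]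

theorem symP_eq_zero_of_le_norm (j : ℤ) {ξ : 𝔼} (h : 2 / 3 * 2 ^ j ≤ ‖ξ‖) : ρ.symP j ξ = 0 := by
  rcases le_or_gt j 0 with hj | hj
  · rw [ρ.symP_of_nonpos hj, zero_apply]
  · rw [ρ.symP_apply hj, ρ.low_eq_zero_of_le_norm, Complex.ofReal_zero]
    rw [norm_two_zpow_inv_smul, le_div_iff₀ (by positivity), zpow_sub_one₀ two_ne_zero]
    linarith

theorem symP_eq_one_of_norm_le {j : ℤ} (hj : 1 ≤ j) {ξ : 𝔼} (h : ‖ξ‖ ≤ 3 / 8 * 2 ^ j) :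
    ρ.symP j ξ = 1 := by
  rw [ρ.symP_apply hj, ρ.low_eq_one_of_norm_le, Complex.ofReal_one]
  rw [norm_two_zpow_inv_smul, div_le_iff₀ (by positivity), zpow_sub_one₀ two_ne_zero]
  linarith

theorem symQ_eq_zero_of_norm_le {j : ℤ} (hj : 0 ≤ j) {ξ : 𝔼} (h : ‖ξ‖ ≤ 3 / 4 * 2 ^ j) :
    ρ.symQ j ξ = 0 := by
  rw [ρ.symQ_apply_of_nonneg hj, ρ.ring_eq_zero_of_norm_le, Complex.ofReal_zero]
  rwa [norm_two_zpow_inv_smul, div_le_iff₀ (by positivity)]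

theorem symQ_eq_zero_of_le_norm (j : ℤ) {ξ : 𝔼} (h : 8 / 3 * 2 ^ j ≤ ‖ξ‖) : ρ.symQ j ξ = 0 := by
  rw [symQ_apply, rho]
  split_ifs with hj
  · rw [ρ.low_eq_zero_of_le_norm, Complex.ofReal_zero]
    rw [hj, zpow_neg_one] at h
    linarith
  · rw [ρ.ring_eq_zero_of_le_norm, Complex.ofReal_zero]
    rwa [norm_two_zpow_inv_smul, le_div_iff₀ (by positivity)]
  · exact Complex.ofReal_zero

theorem symP_mul_symQ {j k : ℤ} (hj : -1 ≤ j) (hk : j + 3 ≤ k) (ξ : 𝔼) :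
    ρ.symP k ξ * ρ.symQ j ξ = ρ.symQ j ξ := by
  rcases le_total (8 / 3 * 2 ^ j) ‖ξ‖ with h | h
  · rw [ρ.symQ_eq_zero_of_le_norm j h, mul_zero]
  · have hpow : (2 : ℝ) ^ (j + 3) ≤ 2 ^ k := zpow_le_zpow_right₀ one_le_two hk
    rw [zpow_add₀ two_ne_zero] at hpow
    rw [ρ.symP_eq_one_of_norm_le (by lia), one_mul]
    linarith [zpow_pos (two_pos (α := ℝ)) j]

theorem exists_symP_mul_eq_self {g : 𝔼 → ℂ} (hg : HasCompactSupport g) :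
    ∃ k : ℤ, ∀ ξ, ρ.symP k ξ * g ξ = g ξ := by
  obtain ⟨R, hR⟩ := hg.isBounded.exists_norm_le
  obtain ⟨k, hk⟩ := pow_unbounded_of_one_lt (8 / 3 * R) one_lt_two
  refine ⟨k + 1, fun ξ => ?_⟩
  by_cases hξ : g ξ = 0
  · rw [hξ, mul_zero]
  · have hξR := hR ξ (subset_tsupport g hξ)
    rw [ρ.symP_eq_one_of_norm_le (by lia), one_mul]
    rw [zpow_add_one₀ two_ne_zero, zpow_natCast]
    linarith [norm_nonneg ξ]

theorem symQ_hasCompactSupport (j : ℤ) : HasCompactSupport (ρ.symQ j) :=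
  ρ.rho_hasCompactSupport j

theorem symP_hasCompactSupport (j : ℤ) : HasCompactSupport (ρ.symP j) :=
  HasCompactSupport.of_support_subset_isCompact
    (isCompact_closedBall (0 : 𝔼) (2 / 3 * 2 ^ j)) fun ξ hξ => by
      rw [mem_closedBall_zero_iff]
      exact (not_le.1 fun h => hξ (ρ.symP_eq_zero_of_le_norm j h)).le

theorem rho_neg (i : ℤ) (ξ : 𝔼) : ρ.rho i (-ξ) = ρ.rho i ξ := by
  simp only [rho, smul_neg, ρ.low_radial _ _ (norm_neg ξ), ρ.ring_radial _ _ (norm_neg _)]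

theorem im_kerQ (i : ℤ) (x : 𝔼) : (ρ.kerQ i x).im = 0 :=
  im_fourierInv_eq_zero (g := ρ.symQ i) (fun _ => by simp [symQ_apply])
    (fun ξ => by simp [symQ_apply, rho_neg]) x

theorem im_kerP (j : ℤ) (x : 𝔼) : (ρ.kerP j x).im = 0 := by
  rw [kerP, sum_apply, Complex.im_sum]
  exact Finset.sum_eq_zero fun i _ => ρ.im_kerQ i x

theorem integral_kerP {j : ℤ} (hj : 1 ≤ j) : ∫ x, ρ.kerP j x = 1 := by
  have hfourier : 𝓕 (ρ.kerP j) 0 = ρ.symP j 0 := by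
    rw [kerP_eq_fourierInv, FourierTransform.fourier_fourierInv_eq]
  rw [ρ.symP_eq_one_of_norm_le hj (by rw [norm_zero]; positivity), SchwartzMap.fourier_coe,
    Real.fourier_eq] at hfourier
  simpa using hfourier

theorem hasScaledMoments_kerP : HasScaledMoments ρ.kerP := by
  have hdilate := hasScaledMoments_fourierInv_of_dilate (g := ρ.symP) fun j hj ξ => by
    rw [ρ.symP_apply hj, ρ.symP_apply le_rfl, sub_self, zpow_zero, inv_one, one_smul]
  simpa only [← kerP_eq_fourierInv] using hdilate

theorem hasScaledMoments_kerQ : HasScaledMoments ρ.kerQ :=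
  hasScaledMoments_fourierInv_of_dilate (g := ρ.symQ) fun j hj ξ => by
    rw [ρ.symQ_apply_of_nonneg (by lia), ρ.symQ_apply_of_nonneg zero_le_one, smul_smul,
      ← mul_inv, ← zpow_add₀ two_ne_zero, add_sub_cancel]

end DyadicPartition

end Kernels

section RepresentedBy

variable {V : Type*} [NormedAddCommGroup V] [InnerProductSpace ℝ V] [FiniteDimensional ℝ V]
  [MeasurableSpace V] [BorelSpace V]

/-- `T` is the tempered distribution `φ ↦ ∫ φ v` of the measurable function `v`, which is bounded
by `C` everywhere. -/
structure RepresentedBy (T : 𝓢'(V, ℂ)) (v : V → ℂ) (C : ℝ) : Prop where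
  aestronglyMeasurable : AEStronglyMeasurable v
  norm_le : ∀ x, ‖v x‖ ≤ C
  apply_eq : ∀ φ, T φ = ∫ x, φ x * v x

theorem exists_representedBy_toTemperedDistribution (u : Lp ℂ ∞ (volume : Measure V)) :
    ∃ v, RepresentedBy (Lp.toTemperedDistribution u) v ‖u‖ := by
  have hu : ∀ᵐ x, ‖u x‖ ≤ ‖u‖ := by
    have hfin := Lp.eLpNorm_ne_top u
    rw [eLpNorm_exponent_top] at hfin
    filter_upwards [ae_le_eLpNormEssSup (f := u) (μ := volume)] with x hx
    rw [Lp.norm_def, eLpNorm_exponent_top, ← toReal_enorm]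
    exact ENNReal.toReal_mono hfin hx
  classical
  let v : V → ℂ := fun x => if ‖u x‖ ≤ ‖u‖ then u x else 0
  have huv : u =ᵐ[volume] v := by
    filter_upwards [hu] with x hx
    exact (if_pos hx).symm
  refine ⟨v, (Lp.aestronglyMeasurable u).congr huv, fun x => ?_, fun φ => ?_⟩
  · by_cases hx : ‖u x‖ ≤ ‖u‖
    · simp only [v, if_pos hx, hx]
    · simp only [v, if_neg hx, norm_zero, norm_nonneg]
  · rw [Lp.toTemperedDistribution_apply]
    refine integral_congr_ae ?_
    filter_upwards [huv] with x hx
    rw [hx, smul_eq_mul]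

variable {T S : 𝓢'(V, ℂ)} {v w : V → ℂ} {C D : ℝ}

theorem representedBy_toLp (hv : MemLp v ∞ (volume : Measure V)) (hC : ∀ x, ‖v x‖ ≤ C) :
    RepresentedBy (Lp.toTemperedDistribution (hv.toLp v)) v C where
  aestronglyMeasurable := hv.aestronglyMeasurable
  norm_le := hC
  apply_eq φ := by
    rw [Lp.toTemperedDistribution_apply]
    refine integral_congr_ae ?_
    filter_upwards [hv.coeFn_toLp] with x hx
    rw [hx, smul_eq_mul]

namespace RepresentedBy

theorem memLp (h : RepresentedBy T v C) : MemLp v ∞ :=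
  memLp_top_of_bound h.aestronglyMeasurable C (.of_forall h.norm_le)

theorem toTemperedDistribution_toLp (h : RepresentedBy T v C) :
    Lp.toTemperedDistribution (h.memLp.toLp v) = T := by
  ext φ
  rw [(representedBy_toLp h.memLp h.norm_le).apply_eq, h.apply_eq]

theorem integrable (h : RepresentedBy T v C) (φ : 𝓢(V, ℂ)) : Integrable fun x => φ x * v x :=
  φ.integrable.mul_bdd h.aestronglyMeasurable (.of_forall h.norm_le)

theorem sub (hT : RepresentedBy T v C) (hS : RepresentedBy S w D) :
    RepresentedBy (T - S) (fun x => v x - w x) (C + D) where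
  aestronglyMeasurable := hT.aestronglyMeasurable.sub hS.aestronglyMeasurable
  norm_le x := norm_sub_le_of_le (hT.norm_le x) (hS.norm_le x)
  apply_eq φ := by
    simp only [mul_sub]
    rw [integral_sub (hT.integrable φ) (hS.integrable φ), ← hT.apply_eq, ← hS.apply_eq]
    rfl

theorem sum {ι : Type*} {s : Finset ι} {T : ι → 𝓢'(V, ℂ)} {v : ι → V → ℂ} {C : ι → ℝ}
    (h : ∀ i ∈ s, RepresentedBy (T i) (v i) (C i)) :
    RepresentedBy (∑ i ∈ s, T i) (fun x => ∑ i ∈ s, v i x) (∑ i ∈ s, C i) where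
  aestronglyMeasurable := s.aestronglyMeasurable_fun_sum fun i hi => (h i hi).aestronglyMeasurable
  norm_le x := norm_sum_le_of_le s fun i hi => (h i hi).norm_le x
  apply_eq φ := by
    simp only [Finset.mul_sum]
    rw [integral_finsetSum s fun i hi => (h i hi).integrable φ,
      ← Finset.sum_congr rfl fun i hi => (h i hi).apply_eq φ]
    simp

theorem fourierMultiplier (hT : RepresentedBy T v C) (g : 𝓢(V, ℂ)) :
    RepresentedBy (TemperedDistribution.fourierMultiplierCLM ℂ g T)
      ((𝓕⁻ g : 𝓢(V, ℂ)) ⋆[.mul ℂ ℂ] v) (C * ∫ w, ‖𝓕⁻ g w‖) where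
  aestronglyMeasurable :=
    (continuous_convolution hT.aestronglyMeasurable hT.norm_le).aestronglyMeasurable
  norm_le := norm_convolution_le hT.norm_le
  apply_eq φ := by
    rw [fourierMultiplierCLM_apply_eq_transposeMultiplier, hT.apply_eq,
      integral_transposeMultiplier_mul g φ hT.aestronglyMeasurable hT.norm_le]

end RepresentedBy

end RepresentedBy

section LinftyNorm

variable {d : ℕ}

variable {T : 𝓢'(EuclideanSpace ℝ (Fin d), ℂ)} {v : EuclideanSpace ℝ (Fin d) → ℂ} {C : ℝ}

theorem exists_representedBy_of_linftyNorm_lt (h : linftyNorm T < ENNReal.ofReal C) :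
    ∃ v, RepresentedBy T v C := by
  simp only [linftyNorm, iInf_lt_iff] at h
  obtain ⟨u, rfl, hu⟩ := h
  obtain ⟨v, hv⟩ := exists_representedBy_toTemperedDistribution u
  rw [← ofReal_norm, ENNReal.ofReal_lt_ofReal_iff_of_nonneg (norm_nonneg _)] at hu
  exact ⟨v, hv.aestronglyMeasurable, fun x => (hv.norm_le x).trans hu.le, hv.apply_eq⟩

theorem RepresentedBy.linftyNorm_le (h : RepresentedBy T v C) :
    linftyNorm T ≤ ENNReal.ofReal C := by
  refine (iInf₂_le (h.memLp.toLp v) h.toTemperedDistribution_toLp).trans ?_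
  rw [Lp.enorm_toLp]
  exact eLpNormEssSup_le_of_ae_bound (.of_forall h.norm_le)

theorem RepresentedBy.apply_reflectAt (h : RepresentedBy T v C)
    (K : 𝓢(EuclideanSpace ℝ (Fin d), ℂ)) (x : EuclideanSpace ℝ (Fin d)) :
    T (reflectAt K x) = (K ⋆[.mul ℂ ℂ] v) x := by
  rw [h.apply_eq, convolution_mul_swap]
  simp only [reflectAt_apply]

theorem representedBy_boundedDistribution (f : EuclideanSpace ℝ (Fin d) →ᵇ ℂ) :
    RepresentedBy (boundedDistribution f) f ‖f‖ :=
  representedBy_toLp _ f.norm_coe_le_norm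

end LinftyNorm

section BoundedBlocks

variable {d : ℕ}

local notation "𝔼" => EuclideanSpace ℝ (Fin d)

namespace DyadicPartition

variable (ρ : DyadicPartition d)

/-- All low-frequency truncations of `T` are bounded functions. -/
def HasBoundedBlocks (T : 𝓢'(𝔼, ℂ)) : Prop :=
  ∀ k : ℤ, ∃ v C, RepresentedBy (TemperedDistribution.fourierMultiplierCLM ℂ (ρ.symP k) T) v C

variable {ρ}

variable {T : 𝓢'(EuclideanSpace ℝ (Fin d), ℂ)} {g : 𝓢(EuclideanSpace ℝ (Fin d), ℂ)}

namespace HasBoundedBlocks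

theorem exists_convolution (hT : ρ.HasBoundedBlocks T) (hg : HasCompactSupport g) :
    ∃ v C, AEStronglyMeasurable v ∧ (∀ x, ‖v x‖ ≤ C) ∧
      (∀ z, T (reflectAt (𝓕⁻ g) z) = ((𝓕⁻ g : 𝓢(𝔼, ℂ)) ⋆[.mul ℂ ℂ] v) z) ∧
      ∀ φ, T (transposeMultiplier g φ) = ∫ z, φ z * ((𝓕⁻ g : 𝓢(𝔼, ℂ)) ⋆[.mul ℂ ℂ] v) z := by
  obtain ⟨k, hk⟩ := ρ.exists_symP_mul_eq_self hg
  obtain ⟨v, C, hv⟩ := hT k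
  refine ⟨v, C, hv.aestronglyMeasurable, hv.norm_le, fun z => ?_, fun φ => ?_⟩
  · rw [← transposeMultiplier_reflectAt (ρ.symP k).hasTemperateGrowth hk,
      ← fourierMultiplierCLM_apply_eq_transposeMultiplier, hv.apply_reflectAt]
  · rw [← integral_transposeMultiplier_mul g φ hv.aestronglyMeasurable hv.norm_le, ← hv.apply_eq,
      fourierMultiplierCLM_apply_eq_transposeMultiplier,
      transposeMultiplier_transposeMultiplier (ρ.symP k).hasTemperateGrowth g.hasTemperateGrowth
        g.hasTemperateGrowth hk]

theorem continuous_apply_reflectAt (hT : ρ.HasBoundedBlocks T) (hg : HasCompactSupport g) :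
    Continuous fun z => T (reflectAt (𝓕⁻ g) z) := by
  obtain ⟨v, C, hv, hC, hTv, -⟩ := hT.exists_convolution hg
  simpa only [hTv] using continuous_convolution hv hC

theorem exists_norm_apply_reflectAt_le (hT : ρ.HasBoundedBlocks T) (hg : HasCompactSupport g) :
    ∃ C, ∀ z, ‖T (reflectAt (𝓕⁻ g) z)‖ ≤ C := by
  obtain ⟨v, C, -, hC, hTv, -⟩ := hT.exists_convolution hg
  exact ⟨_, fun z => (hTv z).symm ▸ norm_convolution_le hC z⟩

theorem apply_transposeMultiplier (hT : ρ.HasBoundedBlocks T) (hg : HasCompactSupport g)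
    (φ : 𝓢(𝔼, ℂ)) : T (transposeMultiplier g φ) = ∫ z, φ z * T (reflectAt (𝓕⁻ g) z) := by
  obtain ⟨v, C, -, -, hTv, hTg⟩ := hT.exists_convolution hg
  simp only [hTv, hTg]

theorem sub {S : 𝓢'(𝔼, ℂ)} (hT : ρ.HasBoundedBlocks T) (hS : ρ.HasBoundedBlocks S) :
    ρ.HasBoundedBlocks (T - S) := by
  intro k
  obtain ⟨v, C, hv⟩ := hT k
  obtain ⟨w, D, hw⟩ := hS k
  rw [map_sub]
  exact ⟨_, _, hv.sub hw⟩

end HasBoundedBlocks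

variable {v : EuclideanSpace ℝ (Fin d) → ℂ} {C : ℝ}

theorem hasBoundedBlocks_fourierMultiplier (hT : RepresentedBy T v C) {q : 𝔼 → ℂ}
    (hq : q.HasTemperateGrowth) :
    ρ.HasBoundedBlocks (TemperedDistribution.fourierMultiplierCLM ℂ q T) := by
  intro k
  rw [TemperedDistribution.fourierMultiplierCLM_fourierMultiplierCLM_apply hq
    (ρ.symP k).hasTemperateGrowth,
    show q * ⇑(ρ.symP k) = SchwartzMap.smulLeftCLM ℂ q (ρ.symP k) from
      (SchwartzMap.smulLeftCLM_apply hq _).symm]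
  exact ⟨_, _, hT.fourierMultiplier (SchwartzMap.smulLeftCLM ℂ q (ρ.symP k))⟩

theorem linftyNorm_block_lt {α : ℝ} {C : NNReal} (h : ρ.holderNorm α T ≤ C) {i : ℤ}
    (hi : -1 ≤ i) :
    linftyNorm (ρ.block i T) < ENNReal.ofReal ((C + 1) * 2 ^ (-(i : ℝ) * α)) := by
  have hblock : ENNReal.ofReal ((2 : ℝ) ^ (α * i)) * linftyNorm (ρ.block i T) ≤ C :=
    (le_iSup₂ (f := fun (i : ℤ) (_ : -1 ≤ i) =>
      ENNReal.ofReal ((2 : ℝ) ^ (α * i)) * linftyNorm (ρ.block i T)) i hi).trans h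
  have hpos : (0 : ℝ) < 2 ^ (α * i) := by positivity
  calc linftyNorm (ρ.block i T) ≤ C / ENNReal.ofReal ((2 : ℝ) ^ (α * i)) :=
        (ENNReal.le_div_iff_mul_le (.inl (by simpa using hpos)) (.inl ENNReal.ofReal_ne_top)).2
          (by rwa [mul_comm])
    _ = ENNReal.ofReal (C * 2 ^ (-(i : ℝ) * α)) := by
        rw [show -(i : ℝ) * α = -(α * i) by ring, Real.rpow_neg two_pos.le, ← div_eq_mul_inv,
          ENNReal.ofReal_div_of_pos hpos, ENNReal.ofReal_coe_nnreal]
    _ < ENNReal.ofReal ((C + 1) * 2 ^ (-(i : ℝ) * α)) :=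
        (ENNReal.ofReal_lt_ofReal_iff (by positivity)).2 (by gcongr; exact lt_add_one _)

theorem fourierMultiplierCLM_symP (k : ℤ) (T : 𝓢'(𝔼, ℂ)) :
    TemperedDistribution.fourierMultiplierCLM ℂ (ρ.symP k) T =
      ∑ i ∈ Finset.Icc (-1) (k - 2), ρ.block i T := by
  have hsym : ⇑(ρ.symP k) = fun ξ => ∑ i ∈ Finset.Icc (-1) (k - 2), ρ.symQ i ξ := by
    funext ξ
    rw [symP, sum_apply]
  rw [hsym, TemperedDistribution.fourierMultiplierCLM_sum ℂ
    fun i _ => (ρ.symQ i).hasTemperateGrowth, sum_apply]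
  rfl

theorem hasBoundedBlocks_of_holderNorm_le {α : ℝ} {C : NNReal} (h : ρ.holderNorm α T ≤ C) :
    ρ.HasBoundedBlocks T := by
  have hblock (i : ℤ) (hi : -1 ≤ i) := exists_representedBy_of_linftyNorm_lt
    (linftyNorm_block_lt h hi)
  choose! v hv using hblock
  intro k
  rw [fourierMultiplierCLM_symP]
  exact ⟨_, _, RepresentedBy.sum fun i hi => hv i (Finset.mem_Icc.1 hi).1⟩

theorem norm_apply_reflectAt_kerQ_le {j : ℤ} (hj : -1 ≤ j)
    (h : RepresentedBy (ρ.block j T) v C) (z : 𝔼) :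
    ‖T (reflectAt (ρ.kerQ j) z)‖ ≤ C * ∫ x, ‖ρ.kerP (j + 3) x‖ := by
  have hQ : T (reflectAt (ρ.kerQ j) z) = (ρ.kerP (j + 3) ⋆[.mul ℂ ℂ] v) z := by
    rw [kerQ_eq_fourierInv, kerP_eq_fourierInv,
      ← transposeMultiplier_reflectAt (ρ.symQ j).hasTemperateGrowth (a := ρ.symP (j + 3))
        fun ξ => (mul_comm _ _).trans (ρ.symP_mul_symQ hj le_rfl ξ),
      convolution_mul_swap]
    refine (h.apply_eq _).trans ?_
    simp only [reflectAt_apply]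
  rw [hQ]
  exact norm_convolution_le h.norm_le z

theorem exists_norm_apply_reflectAt_kerQ_le (ρ : DyadicPartition d) (α : ℝ) (C : NNReal) :
    ∃ C' : ℝ, 0 ≤ C' ∧ ∀ T : 𝓢'(𝔼, ℂ), ρ.holderNorm α T ≤ C → ∀ j : ℤ, -1 ≤ j → ∀ z,
      ‖T (reflectAt (ρ.kerQ j) z)‖ ≤ C' * 2 ^ (-(j : ℝ) * α) := by
  obtain ⟨M, hM₀, hM⟩ := ρ.hasScaledMoments_kerP.exists_integral_norm_le
  refine ⟨(C + 1) * M, by positivity, fun T hT j hj z => ?_⟩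
  obtain ⟨v, hv⟩ := exists_representedBy_of_linftyNorm_lt (linftyNorm_block_lt hT hj)
  calc ‖T (reflectAt (ρ.kerQ j) z)‖
      ≤ (C + 1) * 2 ^ (-(j : ℝ) * α) * ∫ x, ‖ρ.kerP (j + 3) x‖ :=
        norm_apply_reflectAt_kerQ_le hj hv z
    _ ≤ (C + 1) * 2 ^ (-(j : ℝ) * α) * M := by gcongr; exact hM _ (by lia)
    _ = (C + 1) * M * 2 ^ (-(j : ℝ) * α) := by ring

end DyadicPartition

end BoundedBlocks

section ScaleWeights

theorem two_rpow_neg_add_mul (γ : ℝ) (j k : ℤ) :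
    (2 : ℝ) ^ (-((j + k : ℤ) : ℝ) * γ) = 2 ^ (-(k : ℝ) * γ) * 2 ^ (-(j : ℝ) * γ) := by
  rw [← Real.rpow_add two_pos]
  push_cast
  ring_nf

theorem one_add_two_zpow_mul_pow_le (n : ℕ) {r : ℝ} (hr : 0 ≤ r) {i j : ℤ} {k : ℕ}
    (h : i ≤ j + k) : (1 + 2 ^ i * r) ^ n ≤ (2 ^ k) ^ n * (1 + 2 ^ j * r) ^ n := by
  rw [← mul_pow]
  have hk : (1 : ℝ) ≤ 2 ^ k := one_le_pow₀ one_le_two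
  have hij : (2 : ℝ) ^ i ≤ 2 ^ k * 2 ^ j := by
    rw [← zpow_natCast, ← zpow_add₀ two_ne_zero, add_comm]
    exact zpow_le_zpow_right₀ one_le_two h
  gcongr
  calc 1 + 2 ^ i * r ≤ 2 ^ k + 2 ^ k * 2 ^ j * r := by gcongr
    _ = 2 ^ k * (1 + 2 ^ j * r) := by ring

theorem rpow_mul_two_rpow_le_one_add_pow {γ b r : ℝ} {n : ℕ} (hb : b ≤ γ) (hn : γ - b ≤ n)
    (hr : 0 ≤ r) (j : ℤ) :
    r ^ (γ - b) * (2 : ℝ) ^ (-(j : ℝ) * b) ≤ 2 ^ (-(j : ℝ) * γ) * (1 + 2 ^ j * r) ^ n := by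
  have hscale : r ^ (γ - b) * (2 : ℝ) ^ (-(j : ℝ) * b) =
      2 ^ (-(j : ℝ) * γ) * (2 ^ j * r) ^ (γ - b) := by
    rw [Real.mul_rpow (by positivity) hr, ← Real.rpow_intCast, ← Real.rpow_mul two_pos.le,
      ← mul_assoc, ← Real.rpow_add two_pos]
    ring_nf
  rw [hscale]
  gcongr
  calc (2 ^ j * r) ^ (γ - b) ≤ (1 + 2 ^ j * r) ^ (γ - b) :=
        Real.rpow_le_rpow (by positivity) (by linarith) (sub_nonneg.2 hb)
    _ ≤ (1 + 2 ^ j * r) ^ (n : ℝ) :=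
        Real.rpow_le_rpow_of_exponent_le (le_add_of_nonneg_right (by positivity)) hn
    _ = (1 + 2 ^ j * r) ^ n := Real.rpow_natCast _ _

end ScaleWeights

section RegularFamily

variable {d : ℕ}

local notation "𝔼" => EuclideanSpace ℝ (Fin d)

namespace DyadicPartition

/-- A family `Λ` which is weakly measurable and bounded in `C^{β₀}`, and whose increment
`Λ_y - Λ_z`, seen at the point `z` and at scale `2^{-j}`, is of order `2^{-jγ}` up to a power of
the distance of `y` and `z` in this scale. It is all the reconstruction needs to know of the
expansion of `Λ_y - Λ_z` in the distributions `Θ^ℓ_z`. -/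
structure RegularFamily (ρ : DyadicPartition d) (γ β₀ : ℝ) (n : ℕ) (Λ : 𝔼 → 𝓢'(𝔼, ℂ))
    (B : NNReal) : Prop where
  measurable_apply : ∀ φ, Measurable fun y => Λ y φ
  holderNorm_le : ∀ y, ρ.holderNorm β₀ (Λ y) ≤ B
  norm_sub_apply_kerP_le : ∀ y z (j : ℤ), -1 ≤ j → ‖(Λ y - Λ z) (reflectAt (ρ.kerP j) z)‖ ≤
    B * (2 ^ (-(j : ℝ) * γ) * (1 + 2 ^ j * ‖y - z‖) ^ n)

/-- The contribution of the frequencies of order `2^j` to `𝐏(Λ) - Λ_x`. The paraproduct starts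
at `j = 1`, but `𝐐_j Λ = 0` for `j ≤ 0`, so that the formula is the right one for all `j ≥ -1`. -/
def localError (ρ : DyadicPartition d) (Λ : 𝔼 → 𝓢'(𝔼, ℂ)) (x : 𝔼) (j : ℤ) (z : 𝔼) : ℂ :=
  ρ.bigQ Λ j z - Λ x (reflectAt (ρ.kerQ j) z)

theorem bigQ_of_nonpos {ρ : DyadicPartition d} {Λ : 𝔼 → 𝓢'(𝔼, ℂ)} {j : ℤ} (hj : j ≤ 0) (x : 𝔼) :
    ρ.bigQ Λ j x = 0 := by
  simp only [bigQ, ρ.kerP_of_nonpos hj, zero_apply, zero_mul, integral_zero]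

section Expansion

variable {N : ℕ} {c : Fin N → EuclideanSpace ℝ (Fin d) → EuclideanSpace ℝ (Fin d) → ℝ}
  {Λ : EuclideanSpace ℝ (Fin d) → 𝓢'(EuclideanSpace ℝ (Fin d), ℂ)}
  {Θ : Fin N → EuclideanSpace ℝ (Fin d) → 𝓢'(EuclideanSpace ℝ (Fin d), ℂ)}

theorem sub_apply_eq_sum_of_expansion (hdec : ∀ x y, Λ y - Λ x = ∑ l, (c l y x : ℂ) • Θ l x)
    (x y : 𝔼) (φ : 𝓢(𝔼, ℂ)) : (Λ y - Λ x) φ = ∑ l, (c l y x : ℂ) * Θ l x φ := by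
  rw [hdec, sum_apply]
  rfl

theorem measurable_apply_of_expansion (hc : ∀ l, Measurable (Function.uncurry (c l)))
    (hdec : ∀ x y, Λ y - Λ x = ∑ l, (c l y x : ℂ) • Θ l x) (φ : 𝓢(𝔼, ℂ)) :
    Measurable fun y => Λ y φ := by
  have hΛ : (fun y => Λ y φ) = fun y => (∑ l, (c l y 0 : ℂ) * Θ l 0 φ) + Λ 0 φ := by
    funext y
    rw [← sub_apply_eq_sum_of_expansion hdec]
    exact (sub_add_cancel (Λ y φ) (Λ 0 φ)).symm
  rw [hΛ]
  exact (Finset.measurable_fun_sum _ fun l _ => ((Complex.measurable_ofReal.comp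
    ((hc l).comp (measurable_id.prodMk measurable_const))).mul_const _)).add_const _

theorem exists_norm_sub_apply_kerP_le_of_expansion (ρ : DyadicPartition d) {γ : ℝ}
    {β : Fin N → ℝ} (hβ : ∀ l, β l ≤ γ)
    (hdec : ∀ x y, Λ y - Λ x = ∑ l, (c l y x : ℂ) • Θ l x)
    (hΘ : ∀ l, ∃ C : ℝ, ∀ x, ∀ j : ℤ, -1 ≤ j →
      (2 : ℝ) ^ ((j : ℝ) * β l) * ‖Θ l x (reflectAt (ρ.kerP j) x)‖ ≤ C)
    (hc : ∀ l, ∃ C : ℝ, ∀ y x, |c l y x| ≤ C * ‖y - x‖ ^ (γ - β l)) :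
    ∃ (n : ℕ) (B : ℝ), ∀ y z (j : ℤ), -1 ≤ j → ‖(Λ y - Λ z) (reflectAt (ρ.kerP j) z)‖ ≤
      B * (2 ^ (-(j : ℝ) * γ) * (1 + 2 ^ j * ‖y - z‖) ^ n) := by
  obtain ⟨a, ha⟩ := (finite_range fun l => γ - β l).bddAbove
  obtain ⟨n, hn⟩ := exists_nat_ge a
  choose Ct hCt using hΘ
  choose Cc hCc using hc
  refine ⟨n, ∑ l, |Cc l| * |Ct l|, fun y z j hj => ?_⟩
  rw [sub_apply_eq_sum_of_expansion hdec, Finset.sum_mul]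
  refine (norm_sum_le _ _).trans (Finset.sum_le_sum fun l _ => ?_)
  have hcl : |c l y z| ≤ |Cc l| * ‖y - z‖ ^ (γ - β l) :=
    (hCc l y z).trans (by gcongr; exact le_abs_self _)
  have hΘl : ‖Θ l z (reflectAt (ρ.kerP j) z)‖ ≤ |Ct l| * 2 ^ (-(j : ℝ) * β l) := by
    rw [neg_mul, Real.rpow_neg two_pos.le, ← div_eq_mul_inv, le_div_iff₀' (by positivity)]
    exact (hCt l z j hj).trans (le_abs_self _)
  calc ‖(c l y z : ℂ) * Θ l z (reflectAt (ρ.kerP j) z)‖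
      = |c l y z| * ‖Θ l z (reflectAt (ρ.kerP j) z)‖ := by
        rw [norm_mul, Complex.norm_real, Real.norm_eq_abs]
    _ ≤ (|Cc l| * ‖y - z‖ ^ (γ - β l)) * (|Ct l| * 2 ^ (-(j : ℝ) * β l)) := by gcongr
    _ = |Cc l| * |Ct l| * (‖y - z‖ ^ (γ - β l) * 2 ^ (-(j : ℝ) * β l)) := by ring
    _ ≤ |Cc l| * |Ct l| * (2 ^ (-(j : ℝ) * γ) * (1 + 2 ^ j * ‖y - z‖) ^ n) := by
        exact mul_le_mul_of_nonneg_left (rpow_mul_two_rpow_le_one_add_pow (hβ l)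
          ((ha (mem_range_self l)).trans hn) (norm_nonneg _) j) (by positivity)

theorem exists_regularFamily {ρ : DyadicPartition d} {γ β₀ : ℝ}
    (hΛ : ∃ C : NNReal, ∀ x, ρ.holderNorm β₀ (Λ x) ≤ C) {β : Fin N → ℝ} (hβ : ∀ l, β l ≤ γ)
    (hc_meas : ∀ l, Measurable (Function.uncurry (c l)))
    (hdec : ∀ x y, Λ y - Λ x = ∑ l, (c l y x : ℂ) • Θ l x)
    (hΘ : ∀ l, ∃ C : ℝ, ∀ x, ∀ j : ℤ, -1 ≤ j →
      (2 : ℝ) ^ ((j : ℝ) * β l) * ‖Θ l x (reflectAt (ρ.kerP j) x)‖ ≤ C)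
    (hc : ∀ l, ∃ C : ℝ, ∀ y x, |c l y x| ≤ C * ‖y - x‖ ^ (γ - β l)) :
    ∃ n B, ρ.RegularFamily γ β₀ n Λ B := by
  obtain ⟨C, hC⟩ := hΛ
  obtain ⟨n, B, hB⟩ := exists_norm_sub_apply_kerP_le_of_expansion ρ hβ hdec hΘ hc
  refine ⟨n, max C B.toNNReal, measurable_apply_of_expansion hc_meas hdec,
    fun y => (hC y).trans (by exact_mod_cast le_max_left _ _), fun y z j hj => ?_⟩
  refine (hB y z j hj).trans ?_
  gcongr
  exact (Real.le_coe_toNNReal B).trans (by exact_mod_cast le_max_right _ _)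

end Expansion

namespace RegularFamily

variable {ρ : DyadicPartition d} {γ β₀ : ℝ} {n : ℕ} {B : NNReal}
  {Λ : EuclideanSpace ℝ (Fin d) → 𝓢'(EuclideanSpace ℝ (Fin d), ℂ)}

theorem hasBoundedBlocks (h : ρ.RegularFamily γ β₀ n Λ B) (y : 𝔼) : ρ.HasBoundedBlocks (Λ y) :=
  hasBoundedBlocks_of_holderNorm_le (h.holderNorm_le y)

theorem exists_norm_apply_kerQ_le (h : ρ.RegularFamily γ β₀ n Λ B) : ∃ C : ℝ, 0 ≤ C ∧
    ∀ j : ℤ, -1 ≤ j → ∀ y z, ‖Λ y (reflectAt (ρ.kerQ j) z)‖ ≤ C * 2 ^ (-(j : ℝ) * β₀) := by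
  obtain ⟨C, hC₀, hC⟩ := exists_norm_apply_reflectAt_kerQ_le ρ β₀ B
  exact ⟨C, hC₀, fun j hj y => hC (Λ y) (h.holderNorm_le y) j hj⟩

theorem norm_sub_apply_kerP_add_le (h : ρ.RegularFamily γ β₀ n Λ B) {j : ℤ} (hj : -1 ≤ j)
    (k : ℕ) (y z : 𝔼) : ‖(Λ y - Λ z) (reflectAt (ρ.kerP (j + k)) z)‖ ≤
      B * 2 ^ (-(k : ℝ) * γ) * (2 ^ k) ^ n *
        (2 ^ (-(j : ℝ) * γ) * (1 + 2 ^ j * ‖y - z‖) ^ n) := by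
  calc ‖(Λ y - Λ z) (reflectAt (ρ.kerP (j + k)) z)‖
      ≤ B * (2 ^ (-((j + k : ℤ) : ℝ) * γ) * (1 + 2 ^ (j + k : ℤ) * ‖y - z‖) ^ n) :=
        h.norm_sub_apply_kerP_le y z (j + k) (by lia)
    _ ≤ B * (2 ^ (-(k : ℝ) * γ) * 2 ^ (-(j : ℝ) * γ) *
          ((2 ^ k) ^ n * (1 + 2 ^ j * ‖y - z‖) ^ n)) := by
        rw [two_rpow_neg_add_mul, Int.cast_natCast]
        gcongr
        exact one_add_two_zpow_mul_pow_le n (norm_nonneg _) le_rfl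
    _ = B * 2 ^ (-(k : ℝ) * γ) * (2 ^ k) ^ n *
          (2 ^ (-(j : ℝ) * γ) * (1 + 2 ^ j * ‖y - z‖) ^ n) := by ring

theorem exists_norm_sub_apply_kerQ_le (h : ρ.RegularFamily γ β₀ n Λ B) : ∃ C : ℝ, 0 ≤ C ∧
    ∀ j : ℤ, -1 ≤ j → ∀ y z, ‖(Λ y - Λ z) (reflectAt (ρ.kerQ j) z)‖ ≤
      C * (2 ^ (-(j : ℝ) * γ) * (1 + 2 ^ j * ‖y - z‖) ^ n) := by
  refine ⟨B * 2 ^ (-((2 : ℕ) : ℝ) * γ) * (2 ^ 2) ^ n + B * 2 ^ (-((1 : ℕ) : ℝ) * γ) * (2 ^ 1) ^ n,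
    by positivity, fun j hj y z => ?_⟩
  have hQ : (Λ y - Λ z) (reflectAt (ρ.kerQ j) z) =
      (Λ y - Λ z) (reflectAt (ρ.kerP (j + (2 : ℕ))) z) -
        (Λ y - Λ z) (reflectAt (ρ.kerP (j + (1 : ℕ))) z) := by
    rw [Nat.cast_ofNat, Nat.cast_one, ρ.kerP_add_two hj, reflectAt_add, map_add,
      add_sub_cancel_left]
  rw [hQ, add_mul]
  exact norm_sub_le_of_le (h.norm_sub_apply_kerP_add_le hj 2 y z)
    (h.norm_sub_apply_kerP_add_le hj 1 y z)

theorem stronglyMeasurable_apply_reflectAt_kerQ (h : ρ.RegularFamily γ β₀ n Λ B) (j : ℤ) :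
    StronglyMeasurable fun p : 𝔼 × 𝔼 => Λ p.2 (reflectAt (ρ.kerQ j) p.1) :=
  stronglyMeasurable_uncurry_of_continuous_of_stronglyMeasurable
    (u := fun x y => Λ y (reflectAt (ρ.kerQ j) x))
    (fun y => (h.hasBoundedBlocks y).continuous_apply_reflectAt (ρ.symQ_hasCompactSupport j))
    (fun _ => (h.measurable_apply _).stronglyMeasurable)

theorem stronglyMeasurable_bigQ (h : ρ.RegularFamily γ β₀ n Λ B) (j : ℤ) :
    StronglyMeasurable (ρ.bigQ Λ j) :=
  StronglyMeasurable.integral_prod_right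
    (f := fun x y => ρ.kerP j (x - y) * Λ y (reflectAt (ρ.kerQ j) x))
    (((ρ.kerP j).continuous.comp (continuous_fst.sub continuous_snd)).stronglyMeasurable.mul
      (h.stronglyMeasurable_apply_reflectAt_kerQ j))

theorem integrable_kernel (h : ρ.RegularFamily γ β₀ n Λ B) {j : ℤ} (hj : -1 ≤ j) (x : 𝔼) :
    Integrable fun y => ρ.kerP j (x - y) * Λ y (reflectAt (ρ.kerQ j) x) := by
  obtain ⟨C, -, hC⟩ := h.exists_norm_apply_kerQ_le
  exact ((ρ.kerP j).integrable.comp_sub_left x).mul_bdd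
    (h.measurable_apply _).aestronglyMeasurable (.of_forall fun y => hC j hj y x)

theorem exists_norm_bigQ_le (h : ρ.RegularFamily γ β₀ n Λ B) : ∃ C : ℝ, 0 ≤ C ∧
    ∀ j : ℤ, -1 ≤ j → ∀ x, ‖ρ.bigQ Λ j x‖ ≤ C * 2 ^ (-(j : ℝ) * β₀) := by
  obtain ⟨M, hM₀, hM⟩ := ρ.hasScaledMoments_kerP.exists_norm_integral_mul_le 0
  obtain ⟨C, hC₀, hC⟩ := h.exists_norm_apply_kerQ_le
  refine ⟨M * C, by positivity, fun j hj x => ?_⟩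
  rw [mul_assoc]
  exact hM j hj x _ _ fun y => by simpa only [pow_zero, mul_one] using hC j hj y x

theorem integrable_mul_bigQ (h : ρ.RegularFamily γ β₀ n Λ B) {j : ℤ} (hj : -1 ≤ j)
    (φ : 𝓢(𝔼, ℂ)) : Integrable fun x => φ x * ρ.bigQ Λ j x := by
  obtain ⟨C, -, hC⟩ := h.exists_norm_bigQ_le
  exact φ.integrable.mul_bdd (h.stronglyMeasurable_bigQ j).aestronglyMeasurable
    (.of_forall (hC j hj))

theorem localError_eq_integral (h : ρ.RegularFamily γ β₀ n Λ B) {j : ℤ} (hj : 1 ≤ j) (x z : 𝔼) :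
    ρ.localError Λ x j z =
      ∫ y, ρ.kerP j (z - y) * (Λ y - Λ x) (reflectAt (ρ.kerQ j) z) := by
  have hconst : Λ x (reflectAt (ρ.kerQ j) z) =
      ∫ y, ρ.kerP j (z - y) * Λ x (reflectAt (ρ.kerQ j) z) := by
    rw [integral_mul_const, integral_sub_left_eq_self (ρ.kerP j) volume z, ρ.integral_kerP hj,
      one_mul]
  rw [localError, hconst, bigQ, ← integral_sub (h.integrable_kernel (by lia) z)
    (((ρ.kerP j).integrable.comp_sub_left z).mul_const _)]
  exact integral_congr_ae (.of_forall fun y => (mul_sub _ _ _).symm)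

theorem exists_norm_localError_le_of_one_le (h : ρ.RegularFamily γ β₀ n Λ B) :
    ∃ C : ℝ, 0 ≤ C ∧ ∀ j : ℤ, 1 ≤ j → ∀ x z,
      ‖ρ.localError Λ x j z‖ ≤ C * (2 ^ (-(j : ℝ) * γ) * (1 + 2 ^ j * ‖x - z‖) ^ n) := by
  obtain ⟨C, hC₀, hC⟩ := h.exists_norm_sub_apply_kerQ_le
  obtain ⟨M, hM₀, hM⟩ := ρ.hasScaledMoments_kerP.exists_norm_integral_mul_le n
  refine ⟨M * (2 * C), by positivity, fun j hj x z => ?_⟩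
  rw [h.localError_eq_integral hj, mul_assoc]
  refine hM j (by lia) z _ _ fun y => ?_
  set s : ℝ := 2 ^ (-(j : ℝ) * γ)
  set X : ℝ := (1 + 2 ^ j * ‖x - z‖) ^ n
  set Y : ℝ := (1 + 2 ^ j * ‖z - y‖) ^ n
  have hX : 1 ≤ X := one_le_pow₀ (le_add_of_nonneg_right (by positivity))
  have hY : 1 ≤ Y := one_le_pow₀ (le_add_of_nonneg_right (by positivity))
  have hs : 0 ≤ s := by positivity
  calc ‖(Λ y - Λ x) (reflectAt (ρ.kerQ j) z)‖
      = ‖(Λ y - Λ z) (reflectAt (ρ.kerQ j) z) - (Λ x - Λ z) (reflectAt (ρ.kerQ j) z)‖ := by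
        rw [← sub_apply, sub_sub_sub_cancel_right]
    _ ≤ C * (s * Y) + C * (s * X) := by
        refine norm_sub_le_of_le ?_ (hC j (by lia) x z)
        simpa only [norm_sub_rev y z] using hC j (by lia) y z
    _ = C * s * (Y + X) := by ring
    _ ≤ C * s * (2 * (X * Y)) :=
        mul_le_mul_of_nonneg_left (by nlinarith) (mul_nonneg hC₀ hs)
    _ = 2 * C * (s * X) * Y := by ring

theorem exists_norm_localError_le_of_le_zero (h : ρ.RegularFamily γ β₀ n Λ B) :
    ∃ C : ℝ, ∀ j : ℤ, -1 ≤ j → j ≤ 0 → ∀ x z,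
      ‖ρ.localError Λ x j z‖ ≤ C * 2 ^ (-(j : ℝ) * γ) := by
  obtain ⟨C, hC₀, hC⟩ := h.exists_norm_apply_kerQ_le
  refine ⟨C * 2 ^ |β₀ - γ|, fun j hj hj₀ x z => ?_⟩
  have hjR : |(-(j : ℝ))| ≤ 1 := by
    have hj' : (-1 : ℝ) ≤ j := by exact_mod_cast hj
    have hj₀' : (j : ℝ) ≤ 0 := by exact_mod_cast hj₀
    exact abs_le.2 ⟨by linarith, by linarith⟩
  have hexp : -(j : ℝ) * (β₀ - γ) ≤ |β₀ - γ| :=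
    (le_abs_self _).trans (abs_mul (-(j : ℝ)) (β₀ - γ) ▸
      mul_le_of_le_one_left (abs_nonneg _) hjR)
  rw [localError, bigQ_of_nonpos hj₀, zero_sub, norm_neg]
  calc ‖Λ x (reflectAt (ρ.kerQ j) z)‖ ≤ C * 2 ^ (-(j : ℝ) * β₀) := hC j hj x z
    _ = C * 2 ^ (-(j : ℝ) * (β₀ - γ)) * 2 ^ (-(j : ℝ) * γ) := by
        rw [mul_assoc, ← Real.rpow_add two_pos]
        ring_nf
    _ ≤ C * 2 ^ |β₀ - γ| * 2 ^ (-(j : ℝ) * γ) := by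
        gcongr
        exact one_le_two

theorem exists_norm_localError_le (h : ρ.RegularFamily γ β₀ n Λ B) :
    ∃ C : ℝ, 0 ≤ C ∧ ∀ j : ℤ, -1 ≤ j → ∀ x z,
      ‖ρ.localError Λ x j z‖ ≤ C * (2 ^ (-(j : ℝ) * γ) * (1 + 2 ^ j * ‖x - z‖) ^ n) := by
  obtain ⟨C, hC₀, hC⟩ := h.exists_norm_localError_le_of_one_le
  obtain ⟨D, hD⟩ := h.exists_norm_localError_le_of_le_zero
  refine ⟨max C D, by positivity, fun j hj x z => ?_⟩
  rcases lt_or_ge 0 j with hj₁ | hj₀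
  · refine (hC j hj₁ x z).trans ?_
    gcongr
    exact le_max_left C D
  · have hW : (1 : ℝ) ≤ (1 + 2 ^ j * ‖x - z‖) ^ n :=
      one_le_pow₀ (le_add_of_nonneg_right (by positivity))
    calc ‖ρ.localError Λ x j z‖ ≤ D * (2 ^ (-(j : ℝ) * γ) * 1) := by
          simpa only [mul_one] using hD j hj hj₀ x z
      _ ≤ max C D * (2 ^ (-(j : ℝ) * γ) * (1 + 2 ^ j * ‖x - z‖) ^ n) := by
          gcongr
          exact le_max_right C D

end RegularFamily

end DyadicPartition

end RegularFamily

section Spectrum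

section InnerProductSpace

variable {V : Type*} [NormedAddCommGroup V] [InnerProductSpace ℝ V] [FiniteDimensional ℝ V]
  [MeasurableSpace V] [BorelSpace V]

/-- The Fourier transform of the function `F` is supported in `s`, in the weak sense that `F` is
orthogonal to the test functions without frequencies in `s`. The integrals are those of bounded
measurable functions in all uses. -/
def HasSpectrumIn (s : Set V) (F : V → ℂ) : Prop :=
  ∀ φ : 𝓢(V, ℂ), (∀ ξ ∈ s, 𝓕⁻ φ ξ = 0) → ∫ x, φ x * F x = 0

variable (V) in
/-- The frequencies of order `2^j`, which are also bounded away from `0` unless `j = -1`. The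
constants are those for which the shell contains the sum of a frequency of `Q_j` and one
of `P_j`. -/
def dyadicShell (j : ℤ) : Set V :=
  {ξ | (0 ≤ j → 1 / 12 * 2 ^ j < ‖ξ‖) ∧ ‖ξ‖ < 10 / 3 * 2 ^ j}

end InnerProductSpace

variable {d : ℕ}

local notation "𝔼" => EuclideanSpace ℝ (Fin d)

theorem fourierInv_reflectAt_eq_zero {g : 𝓢(𝔼, ℂ)} {ξ : 𝔼} (h : g ξ = 0) (x : 𝔼) :
    𝓕⁻ (reflectAt (𝓕⁻ g) x) ξ = 0 := by
  rw [fourierInv_reflectAt, FourierTransform.fourier_fourierInv_eq, h, mul_zero]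

namespace DyadicPartition

variable {ρ : DyadicPartition d} {j : ℤ}

theorem mem_dyadicShell_of_symQ_ne_zero {ξ : 𝔼} (h : ρ.symQ j ξ ≠ 0) : ξ ∈ dyadicShell 𝔼 j := by
  have hj : (0 : ℝ) < 2 ^ j := by positivity
  refine ⟨fun hj₀ => ?_, ?_⟩
  · have hlow := not_le.1 fun hle => h (ρ.symQ_eq_zero_of_norm_le hj₀ hle)
    linarith
  · have hhigh := not_le.1 fun hle => h (ρ.symQ_eq_zero_of_le_norm j hle)
    linarith

theorem add_mem_dyadicShell {ξ η : 𝔼} (hξ : ρ.symQ j ξ ≠ 0) (hη : ρ.symP j η ≠ 0) :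
    ξ + η ∈ dyadicShell 𝔼 j := by
  have hη' : ‖η‖ < 2 / 3 * 2 ^ j := not_le.1 fun hle => hη (ρ.symP_eq_zero_of_le_norm j hle)
  refine ⟨fun hj₀ => ?_, ?_⟩
  · have hlow := not_le.1 fun hle => hξ (ρ.symQ_eq_zero_of_norm_le hj₀ hle)
    have htri : ‖ξ‖ - ‖η‖ ≤ ‖ξ + η‖ := by simpa using norm_sub_norm_le ξ (-η)
    linarith
  · have hhigh := not_le.1 fun hle => hξ (ρ.symQ_eq_zero_of_le_norm j hle)
    linarith [norm_add_le ξ η]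

theorem HasBoundedBlocks.hasSpectrumIn_apply_kerQ {T : 𝓢'(𝔼, ℂ)} (hT : ρ.HasBoundedBlocks T)
    (j : ℤ) : HasSpectrumIn (dyadicShell 𝔼 j) fun z => T (reflectAt (ρ.kerQ j) z) := by
  intro φ hφ
  rw [kerQ_eq_fourierInv, ← hT.apply_transposeMultiplier (ρ.symQ_hasCompactSupport j),
    transposeMultiplier_eq_zero (ρ.symQ j).hasTemperateGrowth
      fun ξ hξ => hφ ξ (mem_dyadicShell_of_symQ_ne_zero hξ), map_zero]

namespace RegularFamily

variable {γ β₀ : ℝ} {n : ℕ} {B : NNReal}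
  {Λ : EuclideanSpace ℝ (Fin d) → 𝓢'(EuclideanSpace ℝ (Fin d), ℂ)}

theorem integrable_prod_kernel (h : ρ.RegularFamily γ β₀ n Λ B) (hj : -1 ≤ j) (φ : 𝓢(𝔼, ℂ)) :
    Integrable (fun p : 𝔼 × 𝔼 => φ p.1 * (ρ.kerP j (p.1 - p.2) *
      Λ p.2 (reflectAt (ρ.kerQ j) p.1))) (volume.prod volume) := by
  obtain ⟨C, -, hC⟩ := h.exists_norm_apply_kerQ_le
  simp only [← mul_assoc]
  exact (integrable_mul_comp_sub φ.integrable (ρ.kerP j).integrable).mul_bdd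
    (h.stronglyMeasurable_apply_reflectAt_kerQ j).aestronglyMeasurable
    (.of_forall fun p => hC j hj p.2 p.1)

theorem hasSpectrumIn_bigQ (h : ρ.RegularFamily γ β₀ n Λ B) (hj : -1 ≤ j) :
    HasSpectrumIn (dyadicShell 𝔼 j) (ρ.bigQ Λ j) := by
  intro φ hφ
  simp only [bigQ, ← integral_const_mul]
  rw [integral_integral_swap (h.integrable_prod_kernel hj φ)]
  refine integral_eq_zero_of_ae (.of_forall fun y => ?_)
  set ψ := SchwartzMap.smulLeftCLM ℂ (SchwartzMap.compSubConstCLM ℂ y (𝓕⁻ (ρ.symP j))) φ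
  have hψ (ξ : 𝔼) (hξ : ρ.symQ j ξ ≠ 0) : 𝓕⁻ ψ ξ = 0 :=
    fourierInv_mul_translate_eq_zero y fun η hη => hφ _ (add_mem_dyadicShell hξ hη)
  calc ∫ x, φ x * (ρ.kerP j (x - y) * Λ y (reflectAt (ρ.kerQ j) x))
      = ∫ x, ψ x * Λ y (reflectAt (𝓕⁻ (ρ.symQ j)) x) := by
        refine integral_congr_ae (.of_forall fun x => ?_)
        simp only [ψ, SchwartzMap.smulLeftCLM_apply_apply (SchwartzMap.hasTemperateGrowth _),
          SchwartzMap.compSubConstCLM_apply, smul_eq_mul, ← kerP_eq_fourierInv,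
          ← kerQ_eq_fourierInv]
        ring
    _ = Λ y (transposeMultiplier (ρ.symQ j) ψ) :=
        ((h.hasBoundedBlocks y).apply_transposeMultiplier (ρ.symQ_hasCompactSupport j) ψ).symm
    _ = 0 := by
        rw [transposeMultiplier_eq_zero (ρ.symQ j).hasTemperateGrowth hψ, map_zero]

theorem integrable_mul_apply_kerQ (h : ρ.RegularFamily γ β₀ n Λ B) (φ : 𝓢(𝔼, ℂ)) (x : 𝔼)
    (j : ℤ) : Integrable fun z => φ z * Λ x (reflectAt (ρ.kerQ j) z) := by
  rw [kerQ_eq_fourierInv]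
  obtain ⟨C, hC⟩ :=
    (h.hasBoundedBlocks x).exists_norm_apply_reflectAt_le (ρ.symQ_hasCompactSupport j)
  exact φ.integrable.mul_bdd ((h.hasBoundedBlocks x).continuous_apply_reflectAt
    (ρ.symQ_hasCompactSupport j)).aestronglyMeasurable (.of_forall hC)

theorem integral_mul_localError (h : ρ.RegularFamily γ β₀ n Λ B) (hj : -1 ≤ j) (φ : 𝓢(𝔼, ℂ))
    (x : 𝔼) : ∫ z, φ z * ρ.localError Λ x j z =
      (∫ z, φ z * ρ.bigQ Λ j z) - ∫ z, φ z * Λ x (reflectAt (ρ.kerQ j) z) := by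
  simp only [localError, mul_sub]
  exact integral_sub (h.integrable_mul_bigQ hj φ) (h.integrable_mul_apply_kerQ φ x j)

theorem hasSpectrumIn_localError (h : ρ.RegularFamily γ β₀ n Λ B) (hj : -1 ≤ j) (x : 𝔼) :
    HasSpectrumIn (dyadicShell 𝔼 j) (ρ.localError Λ x j) := by
  intro φ hφ
  rw [h.integral_mul_localError hj, h.hasSpectrumIn_bigQ hj φ hφ,
    (h.hasBoundedBlocks x).hasSpectrumIn_apply_kerQ j φ hφ, sub_zero]

end RegularFamily

end DyadicPartition

end Spectrum

section Reconstruction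

theorem two_rpow_neg_lt_one {γ : ℝ} (hγ : 0 < γ) : (2 : ℝ) ^ (-γ) < 1 :=
  Real.rpow_lt_one_of_one_lt_of_neg one_lt_two (neg_lt_zero.2 hγ)

theorem exists_sum_Icc_two_rpow_le {t : ℝ} (ht : 0 < t) : ∃ C : ℝ, ∀ m : ℤ, -1 ≤ m →
    ∑ j ∈ Finset.Icc (-1) m, (2 : ℝ) ^ ((j : ℝ) * t) ≤ C * 2 ^ ((m : ℝ) * t) := by
  have hpos : 0 < 1 - (2 : ℝ) ^ (-t) := sub_pos.2 (two_rpow_neg_lt_one ht)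
  refine ⟨(1 - 2 ^ (-t))⁻¹, fun m hm => ?_⟩
  induction m, hm using Int.leInduction with
  | base =>
    rw [Finset.Icc_self, Finset.sum_singleton]
    exact le_mul_of_one_le_left (by positivity)
      ((one_le_inv₀ hpos).2 (sub_le_self _ (by positivity)))
  | succ m hm ih =>
    have hIcc : Finset.Icc (-1) (m + 1) = insert (m + 1) (Finset.Icc (-1) m) := by
      ext j
      simp only [Finset.mem_Icc, Finset.mem_insert]
      lia
    have hstep : (2 : ℝ) ^ ((m : ℝ) * t) = 2 ^ (-t) * 2 ^ (((m + 1 : ℤ) : ℝ) * t) := by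
      rw [← Real.rpow_add two_pos]
      push_cast
      ring_nf
    rw [hIcc, Finset.sum_insert (by simp)]
    rw [hstep] at ih
    refine (add_le_add_right ih _).trans_eq ?_
    field_simp
    ring

variable {d : ℕ}

local notation "𝔼" => EuclideanSpace ℝ (Fin d)

namespace DyadicPartition

variable {ρ : DyadicPartition d} {γ β₀ : ℝ} {n : ℕ} {B : NNReal}
  {Λ : EuclideanSpace ℝ (Fin d) → 𝓢'(EuclideanSpace ℝ (Fin d), ℂ)}
  {T : 𝓢'(EuclideanSpace ℝ (Fin d), ℂ)} {φ : 𝓢(EuclideanSpace ℝ (Fin d), ℂ)}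

theorem IsParaproduct.hasSum_int (hT : ρ.IsParaproduct Λ T) (φ : 𝓢(𝔼, ℂ)) :
    HasSum (fun j : ℤ => ∫ z, φ z * ρ.bigQ Λ j z) (T φ) := by
  have hinj : Function.Injective fun k : ℕ => (k : ℤ) + 1 := fun k l hkl => by simpa using hkl
  refine (hinj.hasSum_iff fun j hj => ?_).1 (hT.hasSum φ)
  have hj₀ : j ≤ 0 := by
    by_contra! hj₁
    exact hj ⟨(j - 1).toNat, by simp only; lia⟩
  simp only [bigQ_of_nonpos hj₀, mul_zero, integral_zero]

theorem HasBoundedBlocks.apply_eq_sum (hT : ρ.HasBoundedBlocks T) {i : ℤ} (hi : -1 ≤ i)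
    (hφ : ∀ ξ, 2 / 3 * 2 ^ i ≤ ‖ξ‖ → 𝓕⁻ φ ξ = 0) :
    T φ = ∑ j ∈ Finset.Icc (-1) (i + 2), ∫ z, φ z * T (reflectAt (ρ.kerQ j) z) := by
  have hφ' : transposeMultiplier (ρ.symP (i + 4)) φ = φ := by
    refine transposeMultiplier_eq_self (ρ.symP (i + 4)).hasTemperateGrowth fun ξ hξ =>
      ρ.symP_eq_one_of_norm_le (by lia) ?_
    have hξ' : ‖ξ‖ < 2 / 3 * 2 ^ i := not_le.1 fun hle => hξ (hφ ξ hle)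
    have hi₀ : (0 : ℝ) < 2 ^ i := by positivity
    rw [zpow_add₀ two_ne_zero]
    norm_num
    linarith
  conv_lhs => rw [← hφ']
  rw [← fourierMultiplierCLM_apply_eq_transposeMultiplier, fourierMultiplierCLM_symP, sum_apply,
    show i + 4 - 2 = i + 2 by ring]
  refine Finset.sum_congr rfl fun j _ => ?_
  rw [kerQ_eq_fourierInv, ← hT.apply_transposeMultiplier (ρ.symQ_hasCompactSupport j)]
  rfl

theorem notMem_dyadicShell_of_le {i j : ℤ} (hi : -1 ≤ i) (hij : i + 3 ≤ j) {ξ : 𝔼}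
    (hξ : ‖ξ‖ ≤ 2 / 3 * 2 ^ i) : ξ ∉ dyadicShell 𝔼 j := by
  rintro ⟨hlow, -⟩
  have hpow : (2 : ℝ) ^ (i + 3) ≤ 2 ^ j := zpow_le_zpow_right₀ one_le_two hij
  rw [zpow_add₀ two_ne_zero] at hpow
  norm_num at hpow
  linarith [hlow (by lia)]

theorem fourierInv_eq_zero_of_mem_dyadicShell {i j : ℤ} (hi : -1 ≤ i) (hij : i + 3 ≤ j)
    (hφ : ∀ ξ, 2 / 3 * 2 ^ i ≤ ‖ξ‖ → 𝓕⁻ φ ξ = 0) {ξ : 𝔼} (hξ : ξ ∈ dyadicShell 𝔼 j) :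
    𝓕⁻ φ ξ = 0 :=
  hφ ξ (not_lt.1 fun hlt => notMem_dyadicShell_of_le hi hij hlt.le hξ)

theorem fourierInv_reflectAt_kerP_eq_zero (i : ℤ) (x : 𝔼) {ξ : 𝔼} (hξ : 2 / 3 * 2 ^ i ≤ ‖ξ‖) :
    𝓕⁻ (reflectAt (ρ.kerP i) x) ξ = 0 := by
  rw [kerP_eq_fourierInv, fourierInv_reflectAt_eq_zero (ρ.symP_eq_zero_of_le_norm i hξ)]

theorem fourierInv_reflectAt_kerQ_eq_zero (k : ℤ) (x : 𝔼) {ξ : 𝔼}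
    (hξ : 2 / 3 * 2 ^ (k + 2) ≤ ‖ξ‖) : 𝓕⁻ (reflectAt (ρ.kerQ k) x) ξ = 0 := by
  rw [kerQ_eq_fourierInv]
  refine fourierInv_reflectAt_eq_zero (ρ.symQ_eq_zero_of_le_norm k (le_of_eq_of_le ?_ hξ)) x
  rw [zpow_add₀ two_ne_zero]
  norm_num
  ring

theorem fourierInv_reflectAt_kerQ_eq_zero_of_mem_dyadicShell {j k : ℤ} (hk : 0 ≤ k)
    (hjk : j + 3 ≤ k) (x : 𝔼) {ξ : 𝔼} (hξ : ξ ∈ dyadicShell 𝔼 j) :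
    𝓕⁻ (reflectAt (ρ.kerQ k) x) ξ = 0 := by
  rw [kerQ_eq_fourierInv]
  refine fourierInv_reflectAt_eq_zero (ρ.symQ_eq_zero_of_norm_le hk (hξ.2.le.trans ?_)) x
  have hpow : (2 : ℝ) ^ (j + 3) ≤ 2 ^ k := zpow_le_zpow_right₀ one_le_two hjk
  rw [zpow_add₀ two_ne_zero] at hpow
  norm_num at hpow
  linarith [show (0 : ℝ) < 2 ^ j by positivity]

namespace RegularFamily

theorem sub_apply_eq_sum (h : ρ.RegularFamily γ β₀ n Λ B) (hT : ρ.IsParaproduct Λ T) {i : ℤ}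
    (hi : -1 ≤ i) (hφ : ∀ ξ, 2 / 3 * 2 ^ i ≤ ‖ξ‖ → 𝓕⁻ φ ξ = 0) (x : 𝔼) :
    (T - Λ x) φ = ∑ j ∈ Finset.Icc (-1) (i + 2), ∫ z, φ z * ρ.localError Λ x j z := by
  have hsum : T φ = ∑ j ∈ Finset.Icc (-1) (i + 2), ∫ z, φ z * ρ.bigQ Λ j z := by
    refine (hT.hasSum_int φ).unique (hasSum_sum_of_ne_finset_zero fun j hj => ?_)
    rcases le_or_gt j 0 with hj₀ | hj₁
    · simp only [bigQ_of_nonpos hj₀, mul_zero, integral_zero]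
    · rw [Finset.mem_Icc, not_and_or, not_le, not_le] at hj
      exact h.hasSpectrumIn_bigQ (by lia) φ fun ξ =>
        fourierInv_eq_zero_of_mem_dyadicShell hi (by lia) hφ
  rw [sub_apply, hsum, (h.hasBoundedBlocks x).apply_eq_sum hi hφ, ← Finset.sum_sub_distrib]
  exact Finset.sum_congr rfl fun j hj =>
    (h.integral_mul_localError (Finset.mem_Icc.1 hj).1 φ x).symm

theorem exists_norm_integral_mul_localError_le (h : ρ.RegularFamily γ β₀ n Λ B)
    {K : ℤ → 𝓢(𝔼, ℂ)} (hK : HasScaledMoments K) : ∃ C : ℝ, 0 ≤ C ∧ ∀ i : ℤ, -1 ≤ i →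
      ∀ j : ℤ, -1 ≤ j → j ≤ i + 4 → ∀ x,
        ‖∫ z, reflectAt (K i) x z * ρ.localError Λ x j z‖ ≤ C * 2 ^ (-(j : ℝ) * γ) := by
  obtain ⟨C, hC₀, hC⟩ := h.exists_norm_localError_le
  obtain ⟨M, hM₀, hM⟩ := hK.exists_norm_integral_mul_le n
  refine ⟨M * (C * (2 ^ 4) ^ n), by positivity, fun i hi j hj hij x => ?_⟩
  simp only [reflectAt_apply]
  refine (hM i hi x _ (C * (2 ^ 4) ^ n * 2 ^ (-(j : ℝ) * γ)) fun z => ?_).trans_eq (by ring)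
  calc ‖ρ.localError Λ x j z‖ ≤ C * (2 ^ (-(j : ℝ) * γ) * (1 + 2 ^ j * ‖x - z‖) ^ n) :=
        hC j hj x z
    _ ≤ C * (2 ^ (-(j : ℝ) * γ) * ((2 ^ 4) ^ n * (1 + 2 ^ i * ‖x - z‖) ^ n)) := by
        gcongr
        exact one_add_two_zpow_mul_pow_le n (norm_nonneg _) hij
    _ = C * (2 ^ 4) ^ n * 2 ^ (-(j : ℝ) * γ) * (1 + 2 ^ i * ‖x - z‖) ^ n := by ring

theorem reconstructs_of_neg (h : ρ.RegularFamily γ β₀ n Λ B) (hT : ρ.IsParaproduct Λ T)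
    (hγ : γ < 0) : ρ.Reconstructs γ Λ T := by
  obtain ⟨C, hC₀, hC⟩ := h.exists_norm_integral_mul_localError_le ρ.hasScaledMoments_kerP
  obtain ⟨S, hS⟩ := exists_sum_Icc_two_rpow_le (neg_pos.2 hγ)
  refine ⟨C * (S * 2 ^ (2 * -γ)), fun x i hi => ?_⟩
  rw [h.sub_apply_eq_sum hT hi fun ξ => fourierInv_reflectAt_kerP_eq_zero i x]
  calc ‖∑ j ∈ Finset.Icc (-1) (i + 2), ∫ z, reflectAt (ρ.kerP i) x z * ρ.localError Λ x j z‖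
      ≤ ∑ j ∈ Finset.Icc (-1) (i + 2), C * 2 ^ ((j : ℝ) * -γ) := by
        refine norm_sum_le_of_le _ fun j hj => ?_
        rw [Finset.mem_Icc] at hj
        simpa only [mul_neg, neg_mul] using hC i hi j hj.1 (by lia) x
    _ ≤ C * (S * 2 ^ (((i + 2 : ℤ) : ℝ) * -γ)) := by
        rw [← Finset.mul_sum]
        exact mul_le_mul_of_nonneg_left (hS (i + 2) (by lia)) hC₀
    _ = C * (S * 2 ^ (2 * -γ)) * 2 ^ (-(i : ℝ) * γ) := by
        rw [mul_assoc, mul_assoc S, ← Real.rpow_add two_pos]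
        push_cast
        ring_nf

theorem exists_norm_sub_apply_kerQ_le_of_pos (h : ρ.RegularFamily γ β₀ n Λ B)
    (hT : ρ.IsParaproduct Λ T) (hγ : 0 < γ) : ∃ C : ℝ, 0 ≤ C ∧ ∀ k : ℤ, -1 ≤ k → ∀ x,
      ‖(T - Λ x) (reflectAt (ρ.kerQ k) x)‖ ≤ C * 2 ^ (-(k : ℝ) * γ) := by
  obtain ⟨C, hC₀, hC⟩ := h.exists_norm_integral_mul_localError_le ρ.hasScaledMoments_kerQ
  refine ⟨7 * (C * 2 ^ (2 * γ)), by positivity, fun k hk x => ?_⟩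
  set s := Finset.Icc (max (-1) (k - 2)) (k + 4)
  have hzero (j : ℤ) (hj : j ∈ Finset.Icc (-1) (k + 2 + 2)) (hjs : j ∉ s) :
      ∫ z, reflectAt (ρ.kerQ k) x z * ρ.localError Λ x j z = 0 := by
    simp only [s, Finset.mem_Icc] at hj hjs
    exact h.hasSpectrumIn_localError hj.1 x _ fun ξ hξ =>
      fourierInv_reflectAt_kerQ_eq_zero_of_mem_dyadicShell (by lia) (by lia) x hξ
  have hbound (j : ℤ) (hj : j ∈ s) :
      ‖∫ z, reflectAt (ρ.kerQ k) x z * ρ.localError Λ x j z‖ ≤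
        C * 2 ^ (2 * γ) * 2 ^ (-(k : ℝ) * γ) := by
    simp only [s, Finset.mem_Icc] at hj
    have hjk : (k : ℝ) - 2 ≤ j := by exact_mod_cast (le_max_right _ _).trans hj.1
    refine (hC k hk j (by lia) (by lia) x).trans ?_
    rw [mul_assoc, ← Real.rpow_add two_pos]
    gcongr
    · exact one_le_two
    · nlinarith
  have hcard : (s.card : ℝ) ≤ 7 := by
    rw [Int.card_Icc]
    exact_mod_cast (show (k + 4 + 1 - max (-1) (k - 2)).toNat ≤ 7 by lia)
  rw [h.sub_apply_eq_sum hT (by lia : -1 ≤ k + 2)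
    fun ξ => fourierInv_reflectAt_kerQ_eq_zero k x,
    ← Finset.sum_subset (Finset.Icc_subset_Icc (le_max_left _ _) (by lia)) hzero]
  calc ‖∑ j ∈ s, ∫ z, reflectAt (ρ.kerQ k) x z * ρ.localError Λ x j z‖
      ≤ ∑ _j ∈ s, C * 2 ^ (2 * γ) * 2 ^ (-(k : ℝ) * γ) := norm_sum_le_of_le _ hbound
    _ = s.card * (C * 2 ^ (2 * γ) * 2 ^ (-(k : ℝ) * γ)) := by
        rw [Finset.sum_const, nsmul_eq_mul]
    _ ≤ 7 * (C * 2 ^ (2 * γ) * 2 ^ (-(k : ℝ) * γ)) := by gcongr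
    _ = 7 * (C * 2 ^ (2 * γ)) * 2 ^ (-(k : ℝ) * γ) := by ring

end RegularFamily

end DyadicPartition

end Reconstruction

section DyadicSeries

variable {V : Type*} [NormedAddCommGroup V] [InnerProductSpace ℝ V]

/-- The symbol `‖ξ‖ ^ (2 m)` of a power of the Laplacian, up to a constant. -/
def normPow (m : ℕ) (ξ : V) : ℂ := (((‖ξ‖ ^ 2) ^ m : ℝ) : ℂ)

theorem hasTemperateGrowth_normPow (m : ℕ) : (normPow (V := V) m).HasTemperateGrowth :=
  Function.Complex.hasTemperateGrowth_ofReal.comp ((Function.hasTemperateGrowth_norm_sq V).pow m)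

theorem normPow_smul (m : ℕ) (r : ℝ) (ξ : V) :
    normPow m (r • ξ) = (((r ^ 2) ^ m : ℝ) : ℂ) * normPow m ξ := by
  rw [normPow, normPow, norm_smul, mul_pow, mul_pow, Real.norm_eq_abs, sq_abs, Complex.ofReal_mul]

theorem exists_schwartzMap_dilate (g : 𝓢(V, ℂ)) {r : ℝ} (hr : r ≠ 0) :
    ∃ g' : 𝓢(V, ℂ), ∀ ξ, g' ξ = g (r⁻¹ • ξ) :=
  ⟨SchwartzMap.compCLMOfContinuousLinearEquiv ℂ
    (ContinuousLinearEquiv.smulLeft (Units.mk0 r⁻¹ (inv_ne_zero hr))) g, fun ξ => by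
      simp [Units.smul_def]⟩

variable [FiniteDimensional ℝ V]

theorem exists_schwartzMap_mul_normPow_eq_one {r R : ℝ} (hr : 0 < r) (hR : 0 < R) (m : ℕ) :
    ∃ κ : 𝓢(V, ℂ), ∀ ξ, r < ‖ξ‖ → ‖ξ‖ < R → κ ξ * normPow m ξ = 1 := by
  let χ : ContDiffBump (0 : V) := ⟨R, R + 1, hR, lt_add_one R⟩
  let η : ContDiffBump (0 : V) := ⟨r / 2, r, half_pos hr, half_lt_self hr⟩
  have hpos (ξ : V) : 0 < (‖ξ‖ ^ 2) ^ m + η ξ := by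
    rcases eq_or_ne ξ 0 with rfl | hξ
    · exact add_pos_of_nonneg_of_pos (by positivity) (η.pos_of_mem_ball (by simpa using hr))
    · exact add_pos_of_pos_of_nonneg (by positivity) η.nonneg
  have hsmooth : ContDiff ℝ ∞ fun ξ => χ ξ / ((‖ξ‖ ^ 2) ^ m + η ξ) :=
    χ.contDiff.div (((contDiff_norm_sq ℝ).pow m).add η.contDiff) fun ξ => (hpos ξ).ne'
  have hsupp : HasCompactSupport fun ξ => χ ξ / ((‖ξ‖ ^ 2) ^ m + η ξ) := by
    simp only [div_eq_mul_inv]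
    exact χ.hasCompactSupport.mul_right
  refine ⟨(hsupp.comp_left (g := fun t : ℝ => (t : ℂ)) Complex.ofReal_zero).toSchwartzMap
    (Complex.ofRealCLM.contDiff.comp hsmooth), fun ξ hrξ hξR => ?_⟩
  change ((χ ξ / ((‖ξ‖ ^ 2) ^ m + η ξ) : ℝ) : ℂ) * normPow m ξ = 1
  have hξ : 0 < ‖ξ‖ := hr.trans hrξ
  rw [χ.one_of_mem_closedBall (by simpa using hξR.le),
    η.zero_of_le_dist (by simpa using hrξ.le), add_zero, normPow, ← Complex.ofReal_mul,
    one_div_mul_cancel (by positivity), Complex.ofReal_one]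

variable [MeasurableSpace V] [BorelSpace V]

variable (V) in
theorem exists_inverse_normPow_on_dyadicShell (m : ℕ) :
    ∃ A : ℝ, 0 ≤ A ∧ ∀ j : ℤ, 0 ≤ j → ∃ κ : 𝓢(V, ℂ),
      (∀ ξ ∈ dyadicShell V j, κ ξ * normPow m ξ = 1) ∧
        ∫ x, ‖𝓕⁻ κ x‖ = ((((2 : ℝ) ^ j)⁻¹) ^ 2) ^ m * A := by
  obtain ⟨κ, hκ⟩ := exists_schwartzMap_mul_normPow_eq_one (V := V) (r := 1 / 12) (R := 10 / 3)
    (by norm_num) (by norm_num) m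
  refine ⟨∫ x, ‖𝓕⁻ κ x‖, by positivity, fun j hj => ?_⟩
  have h2j : (0 : ℝ) < 2 ^ j := by positivity
  obtain ⟨κ', hκ'⟩ := exists_schwartzMap_dilate κ h2j.ne'
  set s : ℝ := ((((2 : ℝ) ^ j)⁻¹) ^ 2) ^ m
  refine ⟨(s : ℂ) • κ', fun ξ hξ => ?_, ?_⟩
  · have hnorm : ‖((2 : ℝ) ^ j)⁻¹ • ξ‖ = ‖ξ‖ / 2 ^ j := by
      rw [norm_smul, norm_inv, Real.norm_of_nonneg h2j.le, inv_mul_eq_div]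
    have hinv := hκ (((2 : ℝ) ^ j)⁻¹ • ξ) (by rw [hnorm, lt_div_iff₀ h2j]; exact hξ.1 hj)
      (by rw [hnorm, div_lt_iff₀ h2j]; exact hξ.2)
    rw [normPow_smul, ← hκ'] at hinv
    rw [smul_apply, smul_eq_mul, ← hinv]
    ring
  · have hscale := integral_norm_fourierInv_dilate_mul h2j hκ' fun _ => 1
    simp only [mul_one] at hscale
    rw [← hscale, ← integral_const_mul, FourierTransform.fourierInv_smul]
    simp only [smul_apply, norm_smul, Complex.norm_real,
      Real.norm_of_nonneg (show 0 ≤ s by positivity)]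

theorem HasSpectrumIn.integral_congr {s : Set V} {F : V → ℂ} {φ ψ : 𝓢(V, ℂ)}
    (hF : HasSpectrumIn s F) (hφ : Integrable fun x => φ x * F x)
    (hψ : Integrable fun x => ψ x * F x) (h : ∀ ξ ∈ s, 𝓕⁻ φ ξ = 𝓕⁻ ψ ξ) :
    ∫ x, φ x * F x = ∫ x, ψ x * F x := by
  rw [← sub_eq_zero, ← integral_sub hφ hψ]
  simp only [← sub_mul]
  refine hF (φ - ψ) fun ξ hξ => ?_
  rw [sub_eq_add_neg, FourierTransform.fourierInv_add, FourierTransform.fourierInv_neg,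
    ← sub_eq_add_neg, sub_apply, h ξ hξ, sub_self]

variable (V) in
theorem exists_toTemperedDistribution_normPow_of_hasSpectrumIn (m : ℕ) :
    ∃ A : ℝ, 0 ≤ A ∧ ∀ (j : ℤ) (F : V → ℂ) (D : ℝ), 0 ≤ j → AEStronglyMeasurable F →
      (∀ x, ‖F x‖ ≤ D) → HasSpectrumIn (dyadicShell V j) F →
        ∃ u : Lp ℂ ∞ (volume : Measure V), ‖u‖ ≤ ((((2 : ℝ) ^ j)⁻¹) ^ 2) ^ m * A * D ∧
          ∀ φ, Lp.toTemperedDistribution u (transposeMultiplier (normPow m) φ) =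
            ∫ x, φ x * F x := by
  obtain ⟨A, hA₀, hA⟩ := exists_inverse_normPow_on_dyadicShell V m
  refine ⟨A, hA₀, fun j F D hj hF hD hspec => ?_⟩
  obtain ⟨κ, hκ, hκA⟩ := hA j hj
  have hD₀ : 0 ≤ D := (norm_nonneg _).trans (hD 0)
  have hφF (φ : 𝓢(V, ℂ)) : Integrable fun x => φ x * F x :=
    φ.integrable.mul_bdd hF (.of_forall hD)
  set v : V → ℂ := (𝓕⁻ κ : 𝓢(V, ℂ)) ⋆[.mul ℂ ℂ] F
  have hvD (x : V) : ‖v x‖ ≤ ((((2 : ℝ) ^ j)⁻¹) ^ 2) ^ m * A * D :=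
    (norm_convolution_le hD x).trans_eq (by rw [hκA, mul_comm])
  have hv : MemLp v ∞ := memLp_top_of_bound
    (continuous_convolution hF hD).aestronglyMeasurable _ (.of_forall hvD)
  refine ⟨hv.toLp v, ?_, fun φ => ?_⟩
  · rw [Lp.norm_toLp]
    exact ENNReal.toReal_le_of_le_ofReal (by positivity)
      (eLpNormEssSup_le_of_ae_bound (.of_forall hvD))
  · rw [(representedBy_toLp hv hvD).apply_eq, ← integral_transposeMultiplier_mul κ _ hF hD]
    refine hspec.integral_congr (hφF _) (hφF _) fun ξ hξ => ?_
    rw [fourierInv_transposeMultiplier κ.hasTemperateGrowth,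
      fourierInv_transposeMultiplier (hasTemperateGrowth_normPow m), ← mul_assoc, hκ ξ hξ, one_mul]

/-- Dividing by a high power of the frequency makes the series converge in `L^∞`. -/
theorem exists_hasSum_of_hasSpectrumIn_dyadicShell {F : ℕ → V → ℂ} {C α : ℝ}
    (hF : ∀ k, AEStronglyMeasurable (F k)) (hC : ∀ k x, ‖F k x‖ ≤ C * 2 ^ ((k : ℝ) * α))
    (hspec : ∀ k : ℕ, HasSpectrumIn (dyadicShell V (k + 1)) (F k)) :
    ∃ (m : ℕ) (u : Lp ℂ ∞ (volume : Measure V)), ∀ φ, HasSum (fun k => ∫ x, φ x * F k x)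
      (TemperedDistribution.fourierMultiplierCLM ℂ (normPow m)
        (Lp.toTemperedDistribution u) φ) := by
  obtain ⟨m, hm⟩ : ∃ m : ℕ, α + 1 ≤ 2 * m := by
    obtain ⟨m, hm⟩ := exists_nat_ge (α + 1)
    exact ⟨m, by linarith [Nat.cast_nonneg (α := ℝ) m]⟩
  obtain ⟨A, hA₀, hA⟩ := exists_toTemperedDistribution_normPow_of_hasSpectrumIn V m
  choose u hu hφ using fun k : ℕ => hA (k + 1) (F k) _ (by lia) (hF k) (hC k) (hspec k)
  have hC₀ : 0 ≤ C := by simpa using (norm_nonneg _).trans (hC 0 0)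
  have hgeom (k : ℕ) : ‖u k‖ ≤ A * C * (1 / 2) ^ k := by
    refine (hu k).trans ?_
    have hexp : ((((2 : ℝ) ^ (k + 1 : ℤ))⁻¹) ^ 2) ^ m * 2 ^ ((k : ℝ) * α) ≤ (1 / 2) ^ k := by
      rw [← pow_mul, one_div, inv_pow 2 k, ← Real.rpow_intCast, ← Real.rpow_neg two_pos.le,
        ← Real.rpow_natCast, ← Real.rpow_mul two_pos.le, ← Real.rpow_add two_pos,
        ← Real.rpow_natCast 2 k, ← Real.rpow_neg two_pos.le]
      refine Real.rpow_le_rpow_of_exponent_le one_le_two ?_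
      push_cast
      nlinarith [Nat.cast_nonneg (α := ℝ) m, Nat.cast_nonneg (α := ℝ) k]
    calc _ = A * C * (((((2 : ℝ) ^ (k + 1 : ℤ))⁻¹) ^ 2) ^ m * 2 ^ ((k : ℝ) * α)) := by ring
      _ ≤ _ := by gcongr
  have hsum : Summable u := .of_norm_bounded
    ((summable_geometric_of_lt_one (by norm_num) one_half_lt_one).mul_left _) hgeom
  refine ⟨m, ∑' k, u k, fun φ => ?_⟩
  have hdist := (hsum.hasSum.mapL (Lp.toTemperedDistributionCLM ℂ volume ∞)).mapL
    (PointwiseConvergenceCLM.evalCLM (RingHom.id ℂ) ℂ (transposeMultiplier (normPow m) φ))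
  simp only [← hφ]
  exact hdist

end DyadicSeries

section ParaproductExists

variable {d : ℕ}

local notation "𝔼" => EuclideanSpace ℝ (Fin d)

namespace DyadicPartition

theorem RegularFamily.exists_isParaproduct {ρ : DyadicPartition d} {γ β₀ : ℝ} {n : ℕ}
    {Λ : 𝔼 → 𝓢'(𝔼, ℂ)} {B : NNReal} (h : ρ.RegularFamily γ β₀ n Λ B) :
    ∃ T : 𝓢'(𝔼, ℂ), ρ.IsParaproduct Λ T ∧ ρ.HasBoundedBlocks T := by
  obtain ⟨C, -, hC⟩ := h.exists_norm_bigQ_le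
  have hbound (k : ℕ) (x : 𝔼) : ‖ρ.bigQ Λ (k + 1) x‖ ≤ C * 2 ^ (-β₀) * 2 ^ ((k : ℝ) * -β₀) := by
    refine (hC (k + 1) (by lia) x).trans_eq ?_
    rw [mul_assoc, ← Real.rpow_add two_pos]
    push_cast
    ring_nf
  obtain ⟨m, u, hu⟩ := exists_hasSum_of_hasSpectrumIn_dyadicShell
    (fun k : ℕ => (h.stronglyMeasurable_bigQ (k + 1)).aestronglyMeasurable) hbound
    fun k => h.hasSpectrumIn_bigQ (by lia)
  obtain ⟨v, hv⟩ := exists_representedBy_toTemperedDistribution u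
  exact ⟨_, ⟨fun j hj => h.integrable_kernel (by lia), fun j hj => h.integrable_mul_bigQ (by lia),
    hu⟩, hasBoundedBlocks_fourierMultiplier hv (hasTemperateGrowth_normPow m)⟩

end DyadicPartition

end ParaproductExists

section LowPassLimit

theorem two_rpow_neg_natCast_mul (γ : ℝ) (n : ℕ) :
    (2 : ℝ) ^ (-(n : ℝ) * γ) = (2 ^ (-γ)) ^ n := by
  rw [← Real.rpow_natCast, ← Real.rpow_mul two_pos.le]
  ring_nf

theorem tendsto_mul_two_rpow_neg_natCast_mul {γ : ℝ} (hγ : 0 < γ) (C : ℝ) :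
    Tendsto (fun n : ℕ => C * (2 : ℝ) ^ (-(n : ℝ) * γ)) atTop (𝓝 0) := by
  simpa only [two_rpow_neg_natCast_mul, mul_zero] using
    (tendsto_pow_atTop_nhds_zero_of_lt_one (by positivity) (two_rpow_neg_lt_one hγ)).const_mul C

variable {d : ℕ}

local notation "𝔼" => EuclideanSpace ℝ (Fin d)

namespace DyadicPartition

variable {ρ : DyadicPartition d} {γ C : ℝ} {S : 𝓢'(EuclideanSpace ℝ (Fin d), ℂ)}
  {x : EuclideanSpace ℝ (Fin d)}

theorem reflectAt_kerP_of_nonpos {j : ℤ} (hj : j ≤ 0) (x : 𝔼) : reflectAt (ρ.kerP j) x = 0 := by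
  ext z
  rw [reflectAt_apply, ρ.kerP_of_nonpos hj, zero_apply, zero_apply]

theorem apply_kerP_succ_sub (S : 𝓢'(𝔼, ℂ)) (n : ℕ) (x : 𝔼) :
    S (reflectAt (ρ.kerP ((n + 1 : ℕ) : ℤ)) x) - S (reflectAt (ρ.kerP n) x) =
      S (reflectAt (ρ.kerQ (n - 1)) x) := by
  have hP : ρ.kerP ((n + 1 : ℕ) : ℤ) = ρ.kerP n + ρ.kerQ (n - 1) := by
    convert ρ.kerP_add_two (j := n - 1) (by lia) using 3 <;> lia
  rw [hP, reflectAt_add, map_add, add_sub_cancel_left]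

theorem dist_apply_kerP_succ_le
    (hS : ∀ k : ℤ, -1 ≤ k → ‖S (reflectAt (ρ.kerQ k) x)‖ ≤ C * 2 ^ (-(k : ℝ) * γ)) (n : ℕ) :
    dist (S (reflectAt (ρ.kerP n) x)) (S (reflectAt (ρ.kerP ((n + 1 : ℕ) : ℤ)) x)) ≤
      C * 2 ^ γ * (2 ^ (-γ)) ^ n := by
  rw [dist_comm, dist_eq_norm, apply_kerP_succ_sub]
  refine (hS (n - 1) (by lia)).trans_eq ?_
  rw [← two_rpow_neg_natCast_mul, mul_assoc, ← Real.rpow_add two_pos]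
  push_cast
  ring_nf

theorem exists_tendsto_apply_kerP (hγ : 0 < γ)
    (hS : ∀ k : ℤ, -1 ≤ k → ‖S (reflectAt (ρ.kerQ k) x)‖ ≤ C * 2 ^ (-(k : ℝ) * γ)) :
    ∃ a, Tendsto (fun n : ℕ => S (reflectAt (ρ.kerP n) x)) atTop (𝓝 a) :=
  cauchySeq_tendsto_of_complete
    (cauchySeq_of_le_geometric _ _ (two_rpow_neg_lt_one hγ) (dist_apply_kerP_succ_le hS))

theorem norm_apply_kerP_sub_le (hγ : 0 < γ)
    (hS : ∀ k : ℤ, -1 ≤ k → ‖S (reflectAt (ρ.kerQ k) x)‖ ≤ C * 2 ^ (-(k : ℝ) * γ)) {a : ℂ}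
    (ha : Tendsto (fun n : ℕ => S (reflectAt (ρ.kerP n) x)) atTop (𝓝 a)) {j : ℤ} (hj : -1 ≤ j) :
    ‖S (reflectAt (ρ.kerP j) x) - a‖ ≤
      C * 2 ^ γ / (1 - 2 ^ (-γ)) * 2 ^ (-(j : ℝ) * γ) := by
  have hnat (n : ℕ) : ‖S (reflectAt (ρ.kerP n) x) - a‖ ≤
      C * 2 ^ γ / (1 - 2 ^ (-γ)) * 2 ^ (-(n : ℝ) * γ) := by
    rw [← dist_eq_norm, two_rpow_neg_natCast_mul, div_mul_eq_mul_div]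
    exact dist_le_of_le_geometric_of_tendsto _ _ (two_rpow_neg_lt_one hγ)
      (dist_apply_kerP_succ_le hS) ha n
  rcases hj.eq_or_lt with rfl | hj₀
  · have hC : 0 ≤ C * 2 ^ γ / (1 - 2 ^ (-γ)) := by
      simpa using (norm_nonneg _).trans (hnat 0)
    have hzero := hnat 0
    rw [Nat.cast_zero, reflectAt_kerP_of_nonpos le_rfl] at hzero
    rw [reflectAt_kerP_of_nonpos (by lia)]
    refine hzero.trans (mul_le_mul_of_nonneg_left ?_ hC)
    exact Real.rpow_le_rpow_of_exponent_le one_le_two (by push_cast; linarith)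
  · obtain ⟨n, rfl⟩ := Int.eq_ofNat_of_zero_le (Int.add_one_le_of_lt hj₀)
    exact_mod_cast hnat n

end DyadicPartition

end LowPassLimit

section CorrectionTerm

variable {d : ℕ}

local notation "𝔼" => EuclideanSpace ℝ (Fin d)

namespace DyadicPartition

namespace RegularFamily

variable {ρ : DyadicPartition d} {γ β₀ C : ℝ} {n : ℕ} {B : NNReal}
  {Λ : EuclideanSpace ℝ (Fin d) → 𝓢'(EuclideanSpace ℝ (Fin d), ℂ)}
  {T : 𝓢'(EuclideanSpace ℝ (Fin d), ℂ)}

theorem norm_sub_apply_kerP_sub_le (h : ρ.RegularFamily γ β₀ n Λ B) {f : 𝔼 → ℂ}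
    (hf : ∀ j : ℤ, -1 ≤ j → ∀ x,
      ‖(T - Λ x) (reflectAt (ρ.kerP j) x) - f x‖ ≤ C * 2 ^ (-(j : ℝ) * γ))
    {j : ℤ} (hj : -1 ≤ j) (x z : 𝔼) :
    ‖(T - Λ x) (reflectAt (ρ.kerP j) z) - f z‖ ≤
      (C + B) * 2 ^ (-(j : ℝ) * γ) * (1 + 2 ^ j * ‖x - z‖) ^ n := by
  have hweight : (1 : ℝ) ≤ (1 + 2 ^ j * ‖x - z‖) ^ n :=
    one_le_pow₀ (le_add_of_nonneg_right (by positivity))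
  have hsplit : (T - Λ x) (reflectAt (ρ.kerP j) z) - f z =
      ((T - Λ z) (reflectAt (ρ.kerP j) z) - f z) - (Λ x - Λ z) (reflectAt (ρ.kerP j) z) := by
    simp only [sub_apply]
    ring
  rw [hsplit]
  calc _ ≤ C * 2 ^ (-(j : ℝ) * γ) + B * (2 ^ (-(j : ℝ) * γ) * (1 + 2 ^ j * ‖x - z‖) ^ n) :=
        norm_sub_le_of_le (hf j hj z) (h.norm_sub_apply_kerP_le x z j hj)
    _ ≤ C * 2 ^ (-(j : ℝ) * γ) * (1 + 2 ^ j * ‖x - z‖) ^ n +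
          B * (2 ^ (-(j : ℝ) * γ) * (1 + 2 ^ j * ‖x - z‖) ^ n) :=
        add_le_add_left
          (le_mul_of_one_le_right ((norm_nonneg _).trans (hf j hj z)) hweight) _
    _ = (C + B) * 2 ^ (-(j : ℝ) * γ) * (1 + 2 ^ j * ‖x - z‖) ^ n := by ring

theorem continuous_of_norm_sub_apply_kerP_sub_le (h : ρ.RegularFamily γ β₀ n Λ B)
    (hT : ρ.HasBoundedBlocks T) (hγ : 0 < γ) {f : 𝔼 → ℂ}
    (hf : ∀ j : ℤ, -1 ≤ j → ∀ x,
      ‖(T - Λ x) (reflectAt (ρ.kerP j) x) - f x‖ ≤ C * 2 ^ (-(j : ℝ) * γ)) : Continuous f := by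
  refine continuous_iff_continuousAt.2 fun x =>
    continuousAt_of_locally_uniform_approx_of_continuousAt fun u hu => ?_
  obtain ⟨ε, hε, hεu⟩ := Metric.mem_uniformity_dist.1 hu
  obtain ⟨j, hj⟩ := ((tendsto_mul_two_rpow_neg_natCast_mul hγ
    ((C + B) * 2 ^ n)).eventually_lt_const hε).exists
  refine ⟨Metric.ball x (2 ^ j)⁻¹, Metric.ball_mem_nhds x (by positivity),
    fun z => (T - Λ x) (reflectAt (ρ.kerP j) z), ?_, fun z hz => hεu ?_⟩
  · rw [kerP_eq_fourierInv]
    exact ((hT.sub (h.hasBoundedBlocks x)).continuous_apply_reflectAt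
      (ρ.symP_hasCompactSupport j)).continuousAt
  have hCB : 0 ≤ C + B := by
    have hC : 0 ≤ C := by simpa using (norm_nonneg _).trans (hf 0 (by lia) x)
    positivity
  have hxz : 2 ^ (j : ℤ) * ‖x - z‖ ≤ 1 := by
    rw [zpow_natCast, ← dist_eq_norm, dist_comm, ← le_inv_mul_iff₀ (by positivity), mul_one]
    exact (Metric.mem_ball.1 hz).le
  rw [dist_comm, dist_eq_norm]
  calc ‖(T - Λ x) (reflectAt (ρ.kerP j) z) - f z‖
      ≤ (C + B) * 2 ^ (-(j : ℝ) * γ) * (1 + 2 ^ (j : ℤ) * ‖x - z‖) ^ n :=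
        h.norm_sub_apply_kerP_sub_le hf (by lia) x z
    _ ≤ (C + B) * 2 ^ (-(j : ℝ) * γ) * (1 + 1) ^ n := by gcongr
    _ = (C + B) * 2 ^ n * 2 ^ (-(j : ℝ) * γ) := by ring
    _ < ε := hj

theorem exists_boundedContinuousFunction (h : ρ.RegularFamily γ β₀ n Λ B)
    (hT : ρ.IsParaproduct Λ T) (hTb : ρ.HasBoundedBlocks T) (hγ : 0 < γ) :
    ∃ (f : 𝔼 →ᵇ ℂ) (C : ℝ),
      (∀ x, Tendsto (fun n : ℕ => (T - Λ x) (reflectAt (ρ.kerP n) x)) atTop (𝓝 (f x))) ∧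
      ∀ j : ℤ, -1 ≤ j → ∀ x,
        ‖(T - Λ x) (reflectAt (ρ.kerP j) x) - f x‖ ≤ C * 2 ^ (-(j : ℝ) * γ) := by
  obtain ⟨C, -, hC⟩ := h.exists_norm_sub_apply_kerQ_le_of_pos hT hγ
  choose f hf using fun x => exists_tendsto_apply_kerP hγ fun k hk => hC k hk x
  have hbound (j : ℤ) (hj : -1 ≤ j) (x : 𝔼) := norm_apply_kerP_sub_le hγ (hC · · x) (hf x) hj
  have hfb (x : 𝔼) : ‖f x‖ ≤ C * 2 ^ γ / (1 - 2 ^ (-γ)) := by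
    simpa [reflectAt_kerP_of_nonpos] using hbound 0 (by lia) x
  exact ⟨.ofNormedAddCommGroup f (h.continuous_of_norm_sub_apply_kerP_sub_le hTb hγ hbound) _ hfb,
    _, hf, hbound⟩

end RegularFamily

end DyadicPartition

end CorrectionTerm

section ApproximateIdentity

theorem tendsto_two_pow_inv : Tendsto (fun n : ℕ => ((2 : ℝ) ^ n)⁻¹) atTop (𝓝[>] 0) :=
  tendsto_inv_atTop_nhdsGT_zero.comp (tendsto_pow_atTop_atTop_of_one_lt one_lt_two)

variable {d : ℕ}

local notation "𝔼" => EuclideanSpace ℝ (Fin d)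

namespace DyadicPartition

theorem symP_natCast_add_one_apply (ρ : DyadicPartition d) (n : ℕ) (ξ : 𝔼) :
    ρ.symP (n + 1) ξ = ρ.symP 1 (((2 : ℝ) ^ n)⁻¹ • ξ) := by
  rw [ρ.symP_apply (by lia), ρ.symP_apply le_rfl, add_sub_cancel_right, sub_self, zpow_zero,
    zpow_natCast, inv_one, one_smul]

theorem tendsto_kerP_convolution (ρ : DyadicPartition d) (f : 𝔼 →ᵇ ℂ) (x : 𝔼) :
    Tendsto (fun n : ℕ => (ρ.kerP (n + 1) ⋆[.mul ℂ ℂ] f) x) atTop (𝓝 (f x)) := by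
  have hdilate (n : ℕ) : (ρ.kerP (n + 1) ⋆[.mul ℂ ℂ] f) x =
      ∫ w, ρ.kerP 1 w * f (x - ((2 : ℝ) ^ n)⁻¹ • w) := by
    rw [kerP_eq_fourierInv, kerP_eq_fourierInv]
    exact convolution_fourierInv_dilate (by positivity) (ρ.symP_natCast_add_one_apply n) f x
  have hmass : f x = ∫ w, ρ.kerP 1 w * f x := by
    rw [integral_mul_const, ρ.integral_kerP le_rfl, one_mul]
  simp only [hdilate]
  rw [hmass]
  refine tendsto_integral_of_dominated_convergence (fun w => ‖ρ.kerP 1 w‖ * ‖f‖) (fun n => ?_)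
    ((ρ.kerP 1).integrable.norm.mul_const _) (fun n => .of_forall fun w => ?_)
    (.of_forall fun w => ?_)
  · exact ((ρ.kerP 1).continuous.mul (f.continuous.comp
      (continuous_const.sub (continuous_const_smul _)))).aestronglyMeasurable
  · rw [norm_mul]
    gcongr
    exact f.norm_coe_le_norm _
  · refine tendsto_const_nhds.mul ((f.continuous.tendsto x).comp ?_)
    simpa using tendsto_const_nhds.sub
      ((tendsto_two_pow_inv.mono_right nhdsWithin_le_nhds).smul_const w)

theorem tendsto_boundedDistribution_apply_kerP (ρ : DyadicPartition d) (f : 𝔼 →ᵇ ℂ) (x : 𝔼) :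
    Tendsto (fun n : ℕ => boundedDistribution f (reflectAt (ρ.kerP n) x)) atTop (𝓝 (f x)) := by
  refine (tendsto_add_atTop_iff_nat 1).1 ?_
  simpa only [(representedBy_boundedDistribution f).apply_reflectAt, Nat.cast_add, Nat.cast_one]
    using ρ.tendsto_kerP_convolution f x

theorem tendsto_transposeMultiplier_symP (ρ : DyadicPartition d) (φ : 𝓢(𝔼, ℂ)) :
    Tendsto (fun n : ℕ => transposeMultiplier (ρ.symP (n + 1)) φ) atTop (𝓝 φ) := by
  have hmult := (tendsto_smulLeftCLM_comp_smul (χ := ρ.symP 1) (r := 3 / 4) (by norm_num)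
    (fun ξ hξ => ρ.symP_eq_one_of_norm_le le_rfl (by norm_num; exact hξ.le)) (𝓕⁻ φ)).comp
      tendsto_two_pow_inv
  have hfourier :=
    ((FourierTransform.fourierCLM ℂ 𝓢(𝔼, ℂ)).continuous.tendsto (𝓕⁻ φ)).comp hmult
  simp only [FourierTransform.fourierCLM_apply, FourierTransform.fourier_fourierInv_eq] at hfourier
  refine hfourier.congr fun n => ?_
  simp only [Function.comp_apply, ← symP_natCast_add_one_apply]
  rfl

variable {ρ : DyadicPartition d} {S : 𝓢'(EuclideanSpace ℝ (Fin d), ℂ)} {γ C : ℝ}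

theorem HasBoundedBlocks.eq_zero_of_norm_apply_kerP_le (hS : ρ.HasBoundedBlocks S) (hγ : 0 < γ)
    (h : ∀ j : ℤ, -1 ≤ j → ∀ x, ‖S (reflectAt (ρ.kerP j) x)‖ ≤ C * 2 ^ (-(j : ℝ) * γ)) :
    S = 0 := by
  ext φ
  have hlim : Tendsto (fun n : ℕ => S (transposeMultiplier (ρ.symP (n + 1)) φ)) atTop
      (𝓝 (S φ)) :=
    (S.continuous.tendsto φ).comp (ρ.tendsto_transposeMultiplier_symP φ)
  refine tendsto_nhds_unique hlim (squeeze_zero_norm (fun n => ?_) <|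
    (tendsto_add_atTop_iff_nat 1).2 <|
      tendsto_mul_two_rpow_neg_natCast_mul hγ ((∫ z, ‖φ z‖) * C))
  rw [hS.apply_transposeMultiplier (ρ.symP_hasCompactSupport _), ← kerP_eq_fourierInv]
  refine (norm_integral_mul_le_of_norm_le φ.integrable (h (n + 1) (by lia))).trans_eq ?_
  push_cast
  ring

end DyadicPartition

end ApproximateIdentity

section Hoelder

variable {d : ℕ}

local notation "𝔼" => EuclideanSpace ℝ (Fin d)

namespace DyadicPartition

variable {ρ : DyadicPartition d} {γ β₀ C C₀ : ℝ} {n : ℕ} {B : NNReal}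
  {Λ : EuclideanSpace ℝ (Fin d) → 𝓢'(EuclideanSpace ℝ (Fin d), ℂ)}
  {S T : 𝓢'(EuclideanSpace ℝ (Fin d), ℂ)} {v : EuclideanSpace ℝ (Fin d) → ℂ}

theorem transposeMultiplier_symP_reflectAt_kerQ (ρ : DyadicPartition d) {k : ℤ} (hk : -1 ≤ k)
    (x : 𝔼) : transposeMultiplier (ρ.symP k) (reflectAt (ρ.kerQ k) x) = 0 := by
  refine transposeMultiplier_eq_zero (ρ.symP k).hasTemperateGrowth fun ξ hξ => ?_
  rcases hk.eq_or_lt with rfl | hk₀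
  · rw [symP_of_nonpos _ (by lia), zero_apply] at hξ
    exact absurd rfl hξ
  · rw [kerQ_eq_fourierInv]
    refine fourierInv_reflectAt_eq_zero (ρ.symQ_eq_zero_of_norm_le (by lia) ?_) x
    have hlt : ‖ξ‖ < 2 / 3 * 2 ^ k := not_le.1 fun hle => hξ (ρ.symP_eq_zero_of_le_norm k hle)
    linarith [show (0 : ℝ) < 2 ^ k by positivity]

theorem HasBoundedBlocks.integral_kerQ_mul_apply_kerP (hS : ρ.HasBoundedBlocks S) {k : ℤ}
    (hk : -1 ≤ k) (x : 𝔼) : ∫ z, ρ.kerQ k (x - z) * S (reflectAt (ρ.kerP k) z) = 0 := by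
  have hzero := hS.apply_transposeMultiplier (ρ.symP_hasCompactSupport k) (reflectAt (ρ.kerQ k) x)
  rw [transposeMultiplier_symP_reflectAt_kerQ ρ hk, map_zero, ← kerP_eq_fourierInv] at hzero
  simpa only [reflectAt_apply] using hzero.symm

theorem memHolder_of_norm_apply_kerQ_le (hT : RepresentedBy T v C₀)
    (hC : ∀ k : ℤ, -1 ≤ k → ∀ x, ‖T (reflectAt (ρ.kerQ k) x)‖ ≤ C * 2 ^ (-(k : ℝ) * γ)) :
    ρ.MemHolder γ T := by
  refine lt_of_le_of_lt (iSup₂_le fun k hk => ?_) (ENNReal.ofReal_lt_top (r := C))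
  have hmult := hT.fourierMultiplier (ρ.symQ k)
  have hblock : RepresentedBy (ρ.block k T) (ρ.kerQ k ⋆[.mul ℂ ℂ] v)
      (C * 2 ^ (-(k : ℝ) * γ)) :=
    ⟨hmult.aestronglyMeasurable, fun x => hT.apply_reflectAt (ρ.kerQ k) x ▸ hC k hk x,
      hmult.apply_eq⟩
  calc ENNReal.ofReal ((2 : ℝ) ^ (γ * k)) * linftyNorm (ρ.block k T)
      ≤ ENNReal.ofReal ((2 : ℝ) ^ (γ * k)) * ENNReal.ofReal (C * 2 ^ (-(k : ℝ) * γ)) := by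
        gcongr
        exact hblock.linftyNorm_le
    _ = ENNReal.ofReal (C * 2 ^ (γ * k + -(k : ℝ) * γ)) := by
        rw [← ENNReal.ofReal_mul (by positivity), mul_left_comm, ← Real.rpow_add two_pos]
    _ = ENNReal.ofReal C := by
        rw [neg_mul, mul_comm γ, add_neg_cancel, Real.rpow_zero, mul_one]

theorem RegularFamily.exists_norm_boundedDistribution_apply_kerQ_le
    (h : ρ.RegularFamily γ β₀ n Λ B) (hT : ρ.HasBoundedBlocks T) {f : 𝔼 →ᵇ ℂ}
    (hf : ∀ j : ℤ, -1 ≤ j → ∀ x,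
      ‖(T - Λ x) (reflectAt (ρ.kerP j) x) - f x‖ ≤ C * 2 ^ (-(j : ℝ) * γ)) :
    ∃ D : ℝ, ∀ k : ℤ, -1 ≤ k → ∀ x,
      ‖boundedDistribution f (reflectAt (ρ.kerQ k) x)‖ ≤ D * 2 ^ (-(k : ℝ) * γ) := by
  obtain ⟨M, -, hM⟩ := ρ.hasScaledMoments_kerQ.exists_norm_integral_mul_le n
  refine ⟨M * (C + B), fun k hk x => ?_⟩
  have hS : ρ.HasBoundedBlocks (T - Λ x) := hT.sub (h.hasBoundedBlocks x)
  have hcont := hS.continuous_apply_reflectAt (ρ.symP_hasCompactSupport k)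
  obtain ⟨D, hD⟩ := hS.exists_norm_apply_reflectAt_le (ρ.symP_hasCompactSupport k)
  rw [← kerP_eq_fourierInv] at hcont hD
  have hkerQ : Integrable fun z => ρ.kerQ k (x - z) := (ρ.kerQ k).integrable.comp_sub_left x
  have hsub : boundedDistribution f (reflectAt (ρ.kerQ k) x) =
      -∫ z, ρ.kerQ k (x - z) * ((T - Λ x) (reflectAt (ρ.kerP k) z) - f z) := by
    simp only [mul_sub]
    rw [integral_sub (hkerQ.mul_bdd hcont.aestronglyMeasurable (.of_forall hD))
      (hkerQ.mul_bdd f.continuous.aestronglyMeasurable (.of_forall f.norm_coe_le_norm)),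
      hS.integral_kerQ_mul_apply_kerP hk, zero_sub, neg_neg,
      (representedBy_boundedDistribution f).apply_eq]
    simp only [reflectAt_apply]
  rw [hsub, norm_neg, mul_assoc]
  exact hM k hk x _ _ fun z => h.norm_sub_apply_kerP_sub_le hf hk x z

end DyadicPartition

end Hoelder

section Correction

theorem integral_im_eq_zero {α : Type*} [MeasurableSpace α] {μ : Measure α} {f : α → ℂ}
    (hf : ∀ x, (f x).im = 0) : (∫ x, f x ∂μ).im = 0 := by
  rw [← Complex.conj_eq_iff_im, ← integral_conj]
  exact integral_congr_ae (.of_forall fun x => Complex.conj_eq_iff_im.2 (hf x))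

theorem mul_im_eq_zero {z w : ℂ} (hz : z.im = 0) (hw : w.im = 0) : (z * w).im = 0 := by
  rw [Complex.mul_im, hz, hw, mul_zero, zero_mul, add_zero]

variable {d : ℕ}

local notation "𝔼" => EuclideanSpace ℝ (Fin d)

namespace DyadicPartition

variable {ρ : DyadicPartition d} {γ β₀ C : ℝ} {n : ℕ} {B : NNReal}
  {Λ : EuclideanSpace ℝ (Fin d) → 𝓢'(EuclideanSpace ℝ (Fin d), ℂ)}
  {T g : 𝓢'(EuclideanSpace ℝ (Fin d), ℂ)} {f : EuclideanSpace ℝ (Fin d) →ᵇ ℂ}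

theorem IsParaproduct.isRealDistribution (hT : ρ.IsParaproduct Λ T)
    (hΛ : ∀ x, IsRealDistribution (Λ x)) : IsRealDistribution T := by
  intro φ hφ
  have hterm (n : ℕ) : (∫ x, φ x * ρ.bigQ Λ (n + 1) x).im = 0 :=
    integral_im_eq_zero fun x => mul_im_eq_zero (hφ x) <| integral_im_eq_zero fun y =>
      mul_im_eq_zero (ρ.im_kerP _ _) <| hΛ y _ fun z => by rw [reflectAt_apply, ρ.im_kerQ]
  refine (Complex.hasSum_im (hT.hasSum φ)).unique ?_
  simpa only [hterm] using hasSum_zero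

theorem im_eq_zero_of_tendsto_apply_kerP (hT : ρ.IsParaproduct Λ T)
    (hΛ : ∀ x, IsRealDistribution (Λ x)) {x : 𝔼} {a : ℂ}
    (ha : Tendsto (fun n : ℕ => (T - Λ x) (reflectAt (ρ.kerP n) x)) atTop (𝓝 a)) :
    a.im = 0 := by
  have hreal (n : ℕ) : ((T - Λ x) (reflectAt (ρ.kerP n) x)).im = 0 := by
    have hker (z : 𝔼) : (reflectAt (ρ.kerP n) x z).im = 0 := by rw [reflectAt_apply, ρ.im_kerP]
    rw [sub_apply, Complex.sub_im, hT.isRealDistribution hΛ _ hker, hΛ x _ hker, sub_zero]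
  refine tendsto_nhds_unique ((Complex.continuous_im.tendsto a).comp ha) ?_
  simpa only [Function.comp_def, hreal] using tendsto_const_nhds

theorem reconstructs_sub_boundedDistribution (hγ : 0 < γ)
    (hT : ∀ j : ℤ, -1 ≤ j → ∀ x,
      ‖(T - Λ x) (reflectAt (ρ.kerP j) x) - f x‖ ≤ C * 2 ^ (-(j : ℝ) * γ))
    {D : ℝ} (hf : ∀ k : ℤ, -1 ≤ k → ∀ x,
      ‖boundedDistribution f (reflectAt (ρ.kerQ k) x)‖ ≤ D * 2 ^ (-(k : ℝ) * γ)) :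
    ρ.Reconstructs γ Λ (T - boundedDistribution f) := by
  refine ⟨C + D * 2 ^ γ / (1 - 2 ^ (-γ)), fun x j hj => ?_⟩
  have hsplit : (T - boundedDistribution f - Λ x) (reflectAt (ρ.kerP j) x) =
      ((T - Λ x) (reflectAt (ρ.kerP j) x) - f x) -
        (boundedDistribution f (reflectAt (ρ.kerP j) x) - f x) := by
    simp only [sub_apply]
    ring
  rw [hsplit, add_mul]
  exact norm_sub_le_of_le (hT j hj x) (norm_apply_kerP_sub_le hγ (hf · · x)
    (ρ.tendsto_boundedDistribution_apply_kerP f x) hj)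

theorem Reconstructs.exists_norm_sub_apply_kerP_le {S₁ S₂ : 𝓢'(𝔼, ℂ)}
    (h₁ : ρ.Reconstructs γ Λ (T - S₁)) (h₂ : ρ.Reconstructs γ Λ (T - S₂)) :
    ∃ C : ℝ, ∀ j : ℤ, -1 ≤ j → ∀ x,
      ‖(S₁ - S₂) (reflectAt (ρ.kerP j) x)‖ ≤ C * 2 ^ (-(j : ℝ) * γ) := by
  obtain ⟨C₁, hC₁⟩ := h₁
  obtain ⟨C₂, hC₂⟩ := h₂
  refine ⟨C₂ + C₁, fun j hj x => ?_⟩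
  have hsplit : (S₁ - S₂) (reflectAt (ρ.kerP j) x) =
      (T - S₂ - Λ x) (reflectAt (ρ.kerP j) x) - (T - S₁ - Λ x) (reflectAt (ρ.kerP j) x) := by
    simp only [sub_apply]
    ring
  rw [hsplit, add_mul]
  exact norm_sub_le_of_le (hC₂ x j hj) (hC₁ x j hj)

theorem MemHolder.hasBoundedBlocks (hg : ρ.MemHolder γ g) : ρ.HasBoundedBlocks g :=
  hasBoundedBlocks_of_holderNorm_le (ENNReal.coe_toNNReal hg.ne).ge

theorem MemHolder.eq_of_reconstructs {g₁ g₂ : 𝓢'(𝔼, ℂ)} (hγ : 0 < γ)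
    (hg₁ : ρ.MemHolder γ g₁) (hg₂ : ρ.MemHolder γ g₂)
    (h₁ : ρ.Reconstructs γ Λ (T - g₁)) (h₂ : ρ.Reconstructs γ Λ (T - g₂)) : g₁ = g₂ := by
  obtain ⟨C, hC⟩ := h₁.exists_norm_sub_apply_kerP_le h₂
  exact sub_eq_zero.1
    ((hg₁.hasBoundedBlocks.sub hg₂.hasBoundedBlocks).eq_zero_of_norm_apply_kerP_le hγ hC)

end DyadicPartition

end Correction

end

theorem mainTheorem4_general {d : ℕ} {ρ : DyadicPartition d} {γ β₀ : ℝ}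
    {Λ : EuclideanSpace ℝ (Fin d) → 𝓢'(EuclideanSpace ℝ (Fin d), ℂ)} {n : ℕ} {B : NNReal}
    (h : ρ.RegularFamily γ β₀ n Λ B) :
    ∃ PΛ : 𝓢'(EuclideanSpace ℝ (Fin d), ℂ), ρ.IsParaproduct Λ PΛ ∧
      (0 < γ → ∃ f : EuclideanSpace ℝ (Fin d) →ᵇ ℂ,
        ρ.MemHolder γ (boundedDistribution f) ∧
        ρ.Reconstructs γ Λ (PΛ - boundedDistribution f) ∧
        (∀ g : 𝓢'(EuclideanSpace ℝ (Fin d), ℂ), ρ.MemHolder γ g →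
          ρ.Reconstructs γ Λ (PΛ - g) → g = boundedDistribution f) ∧
        ((∀ x, IsRealDistribution (Λ x)) → ∀ x, (f x).im = 0)) ∧
      (γ < 0 → ρ.Reconstructs γ Λ PΛ) := by
  obtain ⟨T, hT, hTb⟩ := h.exists_isParaproduct
  refine ⟨T, hT, fun hγ => ?_, h.reconstructs_of_neg hT⟩
  obtain ⟨f, C, hlim, hC⟩ := h.exists_boundedContinuousFunction hT hTb hγ
  obtain ⟨D, hD⟩ := h.exists_norm_boundedDistribution_apply_kerQ_le hTb hC
  have hmem : ρ.MemHolder γ (boundedDistribution f) :=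
    DyadicPartition.memHolder_of_norm_apply_kerQ_le (representedBy_boundedDistribution f) hD
  have hrec := DyadicPartition.reconstructs_sub_boundedDistribution hγ hC hD
  exact ⟨f, hmem, hrec, fun g hg hgrec => hg.eq_of_reconstructs hγ hmem hgrec hrec,
    fun hΛ x => DyadicPartition.im_eq_zero_of_tendsto_apply_kerP hT hΛ (hlim x)⟩

theorem mainTheorem4 {d : ℕ} (ρ : DyadicPartition d) (γ β₀ : ℝ)
    (Λ : EuclideanSpace ℝ (Fin d) → 𝓢'(EuclideanSpace ℝ (Fin d), ℂ))
    (hΛ : ∃ C : NNReal, ∀ x, ρ.holderNorm β₀ (Λ x) ≤ C)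
    (N : ℕ) (β : Fin N → ℝ) (hβ : ∀ l, β l < γ)
    (c : Fin N → EuclideanSpace ℝ (Fin d) → EuclideanSpace ℝ (Fin d) → ℝ)
    (Θ : Fin N → EuclideanSpace ℝ (Fin d) → 𝓢'(EuclideanSpace ℝ (Fin d), ℂ))
    (hc_meas : ∀ l, Measurable (Function.uncurry (c l)))
    (hdec : ∀ x y, Λ y - Λ x = ∑ l, (c l y x : ℂ) • Θ l x)
    (hΘ : ∀ l, ∃ C : ℝ, ∀ x, ∀ j : ℤ, -1 ≤ j →
      (2 : ℝ) ^ ((j : ℝ) * β l) * ‖Θ l x (reflectAt (ρ.kerP j) x)‖ ≤ C)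
    (hc : ∀ l, ∃ C : ℝ, ∀ y x, |c l y x| ≤ C * ‖y - x‖ ^ (γ - β l)) :
    ∃ PΛ : 𝓢'(EuclideanSpace ℝ (Fin d), ℂ), ρ.IsParaproduct Λ PΛ ∧
      (0 < γ → ∃ f : EuclideanSpace ℝ (Fin d) →ᵇ ℂ,
        ρ.MemHolder γ (boundedDistribution f) ∧
        ρ.Reconstructs γ Λ (PΛ - boundedDistribution f) ∧
        (∀ g : 𝓢'(EuclideanSpace ℝ (Fin d), ℂ), ρ.MemHolder γ g →
          ρ.Reconstructs γ Λ (PΛ - g) → g = boundedDistribution f) ∧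
        ((∀ x, IsRealDistribution (Λ x)) → ∀ x, (f x).im = 0)) ∧
      (γ < 0 → ρ.Reconstructs γ Λ PΛ) := by
  obtain ⟨n, B, h⟩ :=
    DyadicPartition.exists_regularFamily hΛ (fun l => (hβ l).le) hc_meas hdec hΘ hc
  exact mainTheorem4_general h
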